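/- All graphs are finite, simple and undirected. $\mathrm{tw}$ denotes treewidth, $G-U$ is the graph obtained by deleting the vertices in $U$, $G[U]$ is the subgraph induced by $U$, $N_G(U)$ is the set of vertices outside $U$ with a neighbour in $U$, $N_G[U]=N_G(U)\cup U$, and $\partial_G(U)$ is the set of vertices of $U$ with a neighbour outside $U$; for a subgraph $H$, $N_G(H)=N_G(V(H))$ and $N_G[H]=N_G[V(H)]$. A graph is *biconnected* if it is connected and has no articulation vertex. A *problem instance* is a pair $(G,t)$ with $G$ a graph and $t\in\mathbb N$. A *modulator* of $G$ is a set $X\subseteq V(G)$ with $\mathrm{tw}(G-X)\le 2$; it is *tidy* if moreover $\mathrm{tw}(G-(X\setminus\{x\}))\le 2$ for every $x\in X$. A *solution* for $(G,t)$ is a modulator of $G$ with at most $t$ vertices. A set $A\subseteq V(G)$ is a *limit-1 subset* for $(G,t)$ if $|A\setminus S|\le 1$ for every solution $S$ for $(G,t)$. The instance $(G,t)$ is *trivial* if $|V(G)|\le 4$, or $\mathrm{tw}(G)\le 2$, or $t=0$, or there is a non-empty connected subgraph $H$ of $G$ such that the graph obtained from $G[N_G[H]]$ by making $N_G(H)$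 a clique has treewidth at most $2$; otherwise it is *non-trivial*. *Frequent path neighbour reduction.* Let $X'$ be a tidy modulator of $G$, let $x\in X'$, and let $P$ be a simple path in $G-X'$ that visits $v_1,v_2,v_3,v_4\in N_G(x)$ in this order. Let $C$ be the connected component of $G-(X'\cup\{v_1,v_4\})$ that contains the part of $P$ strictly between $v_1$ and $v_4$. If $N_G(C)\cap X'$ is a limit-1 subset for $(G-v_2x,t)$, then remove the edge $v_2x$ from $G$. *Ladder reduction.* Let $P$ and $Q$ be vertex-disjoint induced paths in $G$ that visit, in order, the vertices $p_1,\dots,p_9$ and $q_1,\dots,q_9$ respectively, with $p_iq_i\in E(G)$ for $1\le i\le 9$. If $\mathrm{tw}(G[V(P)\cup V(Q)])\le 2$ and $\partial_G(V(P)\cup V(Q))\subseteq\{p_1,p_9,q_1,q_9\}$, then remove the edge $p_5q_5$ from $G$. **Theorem.** There is an algorithm with the following property. Given a non-trivial problem instance $(G,t)$, a tidy modulator $X$ of $G$, and a biconnected induced subgraph $B$ of $G-X$ with $|V(B)|\ge 1988\,|X|+2$, it applies, in time polynomial in $|G|$, the frequent path neighbour reduction or the ladder reduction to an edge of $B$;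 that is, it outputs the instance $(G-e,t)$ for some edge $e\in E(B)$ whose removal is an application of one of these two reductions to $(G,t)$. (In the frequent path neighbour reduction, the tidy modulator $X'$ need not be the given set $X$.) -/

import Mathlib

namespace TidyReduction

/-! ### Graph notions

Graphs are simple graphs on a finite vertex type.  `G - U` is `G.induce Uᶜ` and `G[U]` is
`G.induce U`. -/

section Graphs

variable {V : Type*}

/-- A tree decomposition of `G` of width at most `k`: a finite tree on the nodes `ι` and a bag
`χ b` of vertices for every node `b`, all bags having at most `k + 1` vertices. -/
structure IsTreeDecomposition (G : SimpleGraph V) (k : ℕ) {ι : Type}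
    (T : SimpleGraph ι) (χ : ι → Finset V) : Prop where
  isTree : T.IsTree
  vertex_covered : ∀ v : V, ∃ b, v ∈ χ b
  edge_covered : ∀ u v : V, G.Adj u v → ∃ b, u ∈ χ b ∧ v ∈ χ b
  connected : ∀ v : V, (T.induce {b | v ∈ χ b}).Connected
  width_le : ∀ b, (χ b).card ≤ k + 1

/-- The treewidth of `G` is at most `k`. -/
def TreewidthAtMost (G : SimpleGraph V) (k : ℕ) : Prop :=
  ∃ (ι : Type) (_ : Finite ι) (T : SimpleGraph ι) (χ : ι → Finset V), IsTreeDecomposition G k T χ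

/-- The open neighbourhood `N_G(U)` of a vertex set. -/
def openNbhd (G : SimpleGraph V) (U : Set V) : Set V := {w | w ∉ U ∧ ∃ u ∈ U, G.Adj u w}

/-- The closed neighbourhood `N_G[U]` of a vertex set. -/
def closedNbhd (G : SimpleGraph V) (U : Set V) : Set V := openNbhd G U ∪ U

/-- The boundary `∂_G(U) = N_G(V(G) \ U)`: the vertices of `U` with a neighbour outside `U`. -/
def boundary (G : SimpleGraph V) (U : Set V) : Set V := openNbhd G Uᶜ

/-- The graph on `V` whose edges are all pairs of distinct vertices of `U`. -/
def cliqueOn (U : Set V) : SimpleGraph V where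
  Adj a b := a ∈ U ∧ b ∈ U ∧ a ≠ b
  symm := ⟨fun _ _ h => ⟨h.2.1, h.1, h.2.2.symm⟩⟩
  loopless := ⟨fun _ h => h.2.2 rfl⟩

/-- `C` is the vertex set of a connected component of `G - U`. -/
def IsComponentOfDelete (G : SimpleGraph V) (U C : Set V) : Prop :=
  ∃ c : (G.induce Uᶜ).ConnectedComponent, C = Subtype.val '' c.supp

/-- Deleting `u` increases the number of connected components. -/
def IsArticulationVertex (G : SimpleGraph V) (u : V) : Prop :=
  Nat.card G.ConnectedComponent < Nat.card (G.induce {u}ᶜ).ConnectedComponent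

/-- A graph is biconnected when it is connected and has no articulation vertex. -/
def IsBiconnected (G : SimpleGraph V) : Prop :=
  G.Connected ∧ ∀ u : V, ¬ IsArticulationVertex G u

/-- A (treewidth-2) modulator: `tw(G - X) ≤ 2`. -/
def IsModulator (G : SimpleGraph V) (X : Set V) : Prop :=
  TreewidthAtMost (G.induce Xᶜ) 2

/-- A tidy modulator: it stays a modulator when any one of its vertices is taken out. -/
def IsTidyModulator (G : SimpleGraph V) (X : Set V) : Prop :=
  IsModulator G X ∧ ∀ x ∈ X, IsModulator G (X \ {x})

/-- A solution for `(G, t)`: a modulator with at most `t` vertices. -/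
def IsSolution (G : SimpleGraph V) (t : ℕ) (S : Finset V) : Prop :=
  IsModulator G (S : Set V) ∧ S.card ≤ t

/-- `A` is a limit-`m` subset for `(G, t)`: every solution misses at most `m` vertices of `A`. -/
def IsLimitSubset (G : SimpleGraph V) (t m : ℕ) (A : Set V) : Prop :=
  ∀ S : Finset V, IsSolution G t S → (A \ (S : Set V)).ncard ≤ m

/-- The contract component reduction can be applied to `G`: some (non-empty) connected subgraph `H`
has `tw(G[N[H]] ∪ clique(N(H))) ≤ 2`. -/
def ContractComponentApplicable (G : SimpleGraph V) : Prop :=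
  ∃ H : G.Subgraph, H.Connected ∧
    TreewidthAtMost
      ((G ⊔ cliqueOn (openNbhd G H.verts)).induce (closedNbhd G H.verts)) 2

/-- The trivial problem instances `(G, t)`. -/
def IsTrivialInstance (G : SimpleGraph V) (t : ℕ) : Prop :=
  Nat.card V ≤ 4 ∨ TreewidthAtMost G 2 ∨ t = 0 ∨ ContractComponentApplicable G

/-- The frequent path neighbour reduction, applied to `(G, t)`, may remove the edge `e`.
There are a tidy modulator `X`, a vertex `x ∈ X`, and a simple path `P` in `G - X` that visits, in
this order, the neighbours `v₁, v₂, v₃, v₄` of `x`; `C` is the component of `G - (X ∪ {v₁, v₄})`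
that contains the part of `P` strictly between `v₁` and `v₄`; `N(C) ∩ X` is a limit-1 subset for
`(G - v₂x, t)`; and `e = v₂x`. -/
def FrequentPathNeighbourRemoves (G : SimpleGraph V) (t : ℕ) (e : Sym2 V) : Prop :=
  ∃ (X : Set V) (x a b v₁ v₂ v₃ v₄ : V) (P : G.Walk a b) (C : Set V),
    IsTidyModulator G X ∧ x ∈ X ∧
    P.IsPath ∧ (∀ w ∈ P.support, w ∉ X) ∧
    [v₁, v₂, v₃, v₄].Sublist P.support ∧
    G.Adj x v₁ ∧ G.Adj x v₂ ∧ G.Adj x v₃ ∧ G.Adj x v₄ ∧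
    IsComponentOfDelete G (X ∪ {v₁, v₄}) C ∧
    (∀ w, [v₁, w, v₄].Sublist P.support → w ∈ C) ∧
    IsLimitSubset (G.deleteEdges {s(v₂, x)}) t 1 (openNbhd G C ∩ X) ∧
    e = s(v₂, x)

/-- The ladder reduction, applied to `G`, may remove the edge `e`.
There are two vertex-disjoint induced paths `P`, `Q` in `G` that visit, in order, vertices
`p₁, …, p₉` and `q₁, …, q₉` (indexed from `0` here) with `pᵢqᵢ ∈ E(G)`,
`tw(G[V(P) ∪ V(Q)]) ≤ 2`, `∂(V(P) ∪ V(Q)) ⊆ {p₁, p₉, q₁, q₉}`, and `e = p₅q₅`. -/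
def LadderRemoves (G : SimpleGraph V) (e : Sym2 V) : Prop :=
  ∃ (a b c d : V) (P : G.Walk a b) (Q : G.Walk c d) (p q : Fin 9 → V),
    P.IsPath ∧ P.toSubgraph.IsInduced ∧ Q.IsPath ∧ Q.toSubgraph.IsInduced ∧
    P.support.Disjoint Q.support ∧
    (List.ofFn p).Sublist P.support ∧ (List.ofFn q).Sublist Q.support ∧
    (∀ i, G.Adj (p i) (q i)) ∧
    TreewidthAtMost (G.induce {v | v ∈ P.support ∨ v ∈ Q.support}) 2 ∧
    boundary G {v | v ∈ P.support ∨ v ∈ Q.support} ⊆ {p 0, p 8, q 0, q 8} ∧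
    e = s(p 4, q 4)

end Graphs

/-! ### Random access machine with a step count

A structured random access machine with unit-cost addition and truncated subtraction (and no
multiplication), whose polynomial-time functions are those of Turing machines. -/

/-- A machine state: the registers, and the memory, which is addressed by natural numbers. -/
structure RamState where
  reg : ℕ → ℕ
  mem : ℕ → ℕ

/-- Right-hand sides of instructions. `load e` reads the memory cell whose address is `e`. -/
inductive RamExpr where
  | const (k : ℕ)
  | reg (r : ℕ)
  | load (e : RamExpr)
  | add (e₁ e₂ : RamExpr)
  | sub (e₁ e₂ : RamExpr)

/-- The value of an expression (`sub` is truncated subtraction). -/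
def RamExpr.eval (s : RamState) : RamExpr → ℕ
  | .const k => k
  | .reg r => s.reg r
  | .load e => s.mem (e.eval s)
  | .add e₁ e₂ => e₁.eval s + e₂.eval s
  | .sub e₁ e₂ => e₁.eval s - e₂.eval s

/-- The number of steps it takes to evaluate an expression. -/
def RamExpr.cost : RamExpr → ℕ
  | .const _ => 1
  | .reg _ => 1
  | .load e => e.cost + 1
  | .add e₁ e₂ => e₁.cost + e₂.cost + 1
  | .sub e₁ e₂ => e₁.cost + e₂.cost + 1

/-- Programs. -/
inductive RamProg where
  | assign (r : ℕ) (e : RamExpr)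
  | store (addr e : RamExpr)
  | seq (c₁ c₂ : RamProg)
  | ite (e : RamExpr) (c₁ c₂ : RamProg)
  | loop (e : RamExpr) (c : RamProg)

/-- `Exec c s k s'`: program `c`, started in state `s`, halts after exactly `k` steps in state `s'`.
`ite e c₁ c₂` runs `c₁` if the value of `e` is non-zero and `c₂` otherwise; `loop e c` repeats `c`
while the value of `e` is non-zero. -/
inductive Exec : RamProg → RamState → ℕ → RamState → Prop where
  | assign (r : ℕ) (e : RamExpr) (s : RamState) :
      Exec (.assign r e) s (e.cost + 1) ⟨Function.update s.reg r (e.eval s), s.mem⟩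
  | store (addr e : RamExpr) (s : RamState) :
      Exec (.store addr e) s (addr.cost + e.cost + 1)
        ⟨s.reg, Function.update s.mem (addr.eval s) (e.eval s)⟩
  | seq {c₁ c₂ : RamProg} {s s₁ s₂ : RamState} {k₁ k₂ : ℕ} :
      Exec c₁ s k₁ s₁ → Exec c₂ s₁ k₂ s₂ → Exec (.seq c₁ c₂) s (k₁ + k₂) s₂
  | ite_true {e : RamExpr} {c₁ c₂ : RamProg} {s s' : RamState} {k : ℕ} :
      e.eval s ≠ 0 → Exec c₁ s k s' → Exec (.ite e c₁ c₂) s (e.cost + 1 + k) s'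
  | ite_false {e : RamExpr} {c₁ c₂ : RamProg} {s s' : RamState} {k : ℕ} :
      e.eval s = 0 → Exec c₂ s k s' → Exec (.ite e c₁ c₂) s (e.cost + 1 + k) s'
  | loop_true {e : RamExpr} {c : RamProg} {s s₁ s₂ : RamState} {k₁ k₂ : ℕ} :
      e.eval s ≠ 0 → Exec c s k₁ s₁ → Exec (.loop e c) s₁ k₂ s₂ →
        Exec (.loop e c) s (e.cost + 1 + k₁ + k₂) s₂
  | loop_false {e : RamExpr} {c : RamProg} {s : RamState} :
      e.eval s = 0 → Exec (.loop e c) s (e.cost + 1) s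

/-! ### Input and output -/

open Classical in
/-- The initial state for the input `(G, t)`, `X`, `B`, where `V(G) = {0, …, n - 1}`.
Register `0` holds `n` and register `1` holds `t`.  The memory holds, from address `0` on, the
adjacency matrix of `G` row by row, followed by the characteristic vectors of `X` and of `B`.
Everything else is `0`. -/
noncomputable def inputState {n : ℕ} (G : SimpleGraph (Fin n)) (t : ℕ) (X B : Finset (Fin n)) :
    RamState where
  reg r := if r = 0 then n else if r = 1 then t else 0
  mem a :=
    if (∃ i j : Fin n, G.Adj i j ∧ a = (i : ℕ) * n + j) ∨
        (∃ i ∈ X, a = n * n + (i : ℕ)) ∨ (∃ i ∈ B, a = n * n + n + (i : ℕ))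
    then 1 else 0

open Classical in
/-- The state holds the problem instance `(G, t)`, in the format of the input. -/
def HoldsInstance {n : ℕ} (s : RamState) (G : SimpleGraph (Fin n)) (t : ℕ) : Prop :=
  s.reg 0 = n ∧ s.reg 1 = t ∧
    ∀ i j : Fin n, s.mem ((i : ℕ) * n + j) = if G.Adj i j then 1 else 0

end TidyReduction

open TidyReduction

/-! Combinatorial part. The set `B` is attached to the rest of `G` at few vertices. For `x ∈ X`,
tidiness says that putting `x` back into `G - X` keeps treewidth at most two. Contracting `x`
together with everything it reaches outside `X ∪ B` gives one vertex next to the biconnected graph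
`G[B]`, and in treewidth two such a vertex has at most two neighbours there (`attach_le_two`). Every
vertex outside `B` is reached from some `x`, since otherwise its component could be contracted and
the instance would be trivial. So at most `2|X|` vertices of `B` have neighbours outside `B`
(`ncard_boundary_le`), and all others have degree at least three inside `B`.

A width-two elimination order makes `G[B]` a rooted forest in which the descendants of a vertex see
at most two vertices outside themselves. The degree condition puts all leaves of the forest into the
boundary, and there are no more branching vertices than leaves. A large `B` therefore contains a
chain of 202 non-boundary vertices, each the only child of the one before it (`exists_chain`). As
there are no cut vertices, the chain is a strip of bags `{w (i - 1), z i, w i}`, consecutive ones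
sharing two vertices (`exists_isStrip`).

If `z` stays constant for a while, it is the centre `x` of a fan over a path. With `X ∪ {x}` as tidy
modulator, the two inner path vertices form a component whose only neighbour in the modulator is
`x`, so the frequent path neighbour reduction applies (`IsFan.removes`). If `z` changes often, the
strip splits into two induced paths that advance alternately, and degree three forces rungs between
them: a ladder (`exists_isLadder`, `IsLadder.removes`).

Algorithmic part. Both configurations have bounded size, so a fixed first-order formula over `G` and
`B` recognises them together with the edge to remove. Brute-force evaluation of a fixed formula
takes polynomial time, and this is the whole algorithm (`exists_prog_deleteEdge`). -/

namespace TidyReduction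

/-! ### Running programs within a time bound -/

section Runs

/-- `c`, started in `s`, halts within `N` steps in a state satisfying `Q`. -/
def Runs (c : RamProg) (s : RamState) (N : ℕ) (Q : RamState → Prop) : Prop :=
  ∃ k s', Exec c s k s' ∧ k ≤ N ∧ Q s'

theorem Runs.mono {c s N N'} {Q Q' : RamState → Prop} (h : Runs c s N Q) (hN : N ≤ N')
    (hQ : ∀ s', Q s' → Q' s') : Runs c s N' Q' := by
  obtain ⟨k, s', h1, h2, h3⟩ := h
  exact ⟨k, s', h1, h2.trans hN, hQ _ h3⟩

theorem Runs.assign {r e s} {Q : RamState → Prop}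
    (h : Q ⟨Function.update s.reg r (e.eval s), s.mem⟩) : Runs (.assign r e) s (e.cost + 1) Q :=
  ⟨_, _, Exec.assign r e s, le_rfl, h⟩

theorem Runs.store {a e s} {Q : RamState → Prop}
    (h : Q ⟨s.reg, Function.update s.mem (a.eval s) (e.eval s)⟩) :
    Runs (.store a e) s (a.cost + e.cost + 1) Q :=
  ⟨_, _, Exec.store a e s, le_rfl, h⟩

theorem Runs.seq {c₁ c₂ s N₁ N₂} {Q : RamState → Prop}
    (h : Runs c₁ s N₁ fun s₁ => Runs c₂ s₁ N₂ Q) : Runs (.seq c₁ c₂) s (N₁ + N₂) Q := by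
  obtain ⟨k, s', h1, h2, k', s'', h3, h4, h5⟩ := h
  exact ⟨_, _, Exec.seq h1 h3, Nat.add_le_add h2 h4, h5⟩

theorem Runs.ite {e c₁ c₂ s N} {Q : RamState → Prop}
    (h₁ : e.eval s ≠ 0 → Runs c₁ s N Q) (h₂ : e.eval s = 0 → Runs c₂ s N Q) :
    Runs (.ite e c₁ c₂) s (e.cost + 1 + N) Q := by
  by_cases h : e.eval s = 0
  · obtain ⟨k, s', h1, h2, h3⟩ := h₂ h
    exact ⟨_, _, Exec.ite_false h h1, by omega, h3⟩
  · obtain ⟨k, s', h1, h2, h3⟩ := h₁ h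
    exact ⟨_, _, Exec.ite_true h h1, by omega, h3⟩

/-- The index of the invariant is the number of iterations still to come, so one induction yields
both termination and the time bound. The last summand pays for the final failing test. -/
theorem Runs.loop {e c N} (I : ℕ → RamState → Prop)
    (hstep : ∀ j s, I (j + 1) s → e.eval s ≠ 0 ∧ Runs c s N (I j))
    (hend : ∀ s, I 0 s → e.eval s = 0) (j : ℕ) :
    ∀ s, I j s → Runs (.loop e c) s (j * (N + e.cost + 1) + (e.cost + 1)) (I 0) := by
  induction j with
  | zero => exact fun s hs => ⟨_, _, Exec.loop_false (hend s hs), by omega, hs⟩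
  | succ j ih =>
    intro s hs
    obtain ⟨h0, k, s₁, h1, h2, h3⟩ := hstep j s hs
    obtain ⟨k', s₂, h4, h5, h6⟩ := ih s₁ h3
    exact ⟨_, _, Exec.loop_true h0 h1 h4, by rw [Nat.succ_mul]; omega, h6⟩

end Runs

/-! ### Compiling first-order formulas -/

section Compile

/-- First-order formulas over a graph with a vertex set; the variables are natural numbers. -/
inductive Form where
  | adj (i j : ℕ)
  | eq (i j : ℕ)
  | mem (i : ℕ)
  | not (φ : Form)
  | or (φ ψ : Form)
  | ex (i : ℕ) (φ : Form)

/-- Satisfaction of a formula in the graph `G` with the vertex set `B`. -/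
def Form.Realize {n : ℕ} (G : SimpleGraph (Fin n)) (B : Finset (Fin n)) :
    Form → (ℕ → Fin n) → Prop
  | .adj i j, ρ => G.Adj (ρ i) (ρ j)
  | .eq i j, ρ => ρ i = ρ j
  | .mem i, ρ => ρ i ∈ B
  | .not φ, ρ => ¬ φ.Realize G B ρ
  | .or φ ψ, ρ => φ.Realize G B ρ ∨ ψ.Realize G B ρ
  | .ex i φ, ρ => ∃ x, φ.Realize G B (Function.update ρ i x)

/-- The register holding the vertex assigned to variable `i`. -/
def varReg (i : ℕ) : ℕ := 5 * i + 3
/-- The register holding `n` times the vertex assigned to variable `i`. -/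
def rowReg (i : ℕ) : ℕ := 5 * i + 4
/-- The register holding the truth value computed at depth `d`. -/
def outReg (d : ℕ) : ℕ := 5 * d + 5
/-- First save register at depth `d`. -/
def saveReg (d : ℕ) : ℕ := 5 * d + 6
/-- Second save register at depth `d`. -/
def saveReg' (d : ℕ) : ℕ := 5 * d + 7

/-- The registers that a computation at depth `d` may change. -/
def IsTemp (d r : ℕ) : Prop := 5 * d + 5 ≤ r ∧ r % 5 ≤ 2

/-- Run `c` once for every value of variable `i`. -/
def sweep (i : ℕ) (c : RamProg) : RamProg :=
  .seq (.assign (varReg i) (.const 0)) <| .seq (.assign (rowReg i) (.const 0)) <|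
    .loop (.sub (.reg 0) (.reg (varReg i))) <| .seq c <|
      .seq (.assign (varReg i) (.add (.reg (varReg i)) (.const 1)))
        (.assign (rowReg i) (.add (.reg (rowReg i)) (.reg 0)))

/-- A program that evaluates a formula, leaving a non-zero value in `outReg d` if it is true. -/
def Form.compile : Form → ℕ → RamProg
  | .adj i j, d => .assign (outReg d) (.load (.add (.reg (rowReg i)) (.reg (varReg j))))
  | .eq i j, d => .assign (outReg d) (.sub (.const 1)
      (.add (.sub (.reg (varReg i)) (.reg (varReg j))) (.sub (.reg (varReg j)) (.reg (varReg i)))))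
  | .mem i, d => .assign (outReg d) (.load (.add (.add (.reg 2) (.reg 0)) (.reg (varReg i))))
  | .not φ, d => .seq (φ.compile (d + 1)) (.assign (outReg d) (.sub (.const 1) (.reg (outReg (d + 1)))))
  | .or φ ψ, d => .seq (φ.compile (d + 1)) <| .seq (.assign (outReg d) (.reg (outReg (d + 1)))) <|
      .seq (ψ.compile (d + 1)) (.assign (outReg d) (.add (.reg (outReg d)) (.reg (outReg (d + 1)))))
  | .ex i φ, d =>
      .seq (.assign (saveReg d) (.reg (varReg i))) <|
      .seq (.assign (saveReg' d) (.reg (rowReg i))) <|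
      .seq (.assign (outReg d) (.const 0)) <|
      .seq (sweep i (.seq (φ.compile (d + 1))
        (.assign (outReg d) (.add (.reg (outReg d)) (.reg (outReg (d + 1))))))) <|
      .seq (.assign (varReg i) (.reg (saveReg d))) (.assign (rowReg i) (.reg (saveReg' d)))

/-- A polynomial time bound for `Form.compile`. -/
noncomputable def Form.time : Form → Polynomial ℕ
  | .adj _ _ => 5
  | .eq _ _ => 10
  | .mem _ => 7
  | .not φ => φ.time + 4
  | .or φ ψ => φ.time + ψ.time + 6
  | .ex _ φ => Polynomial.X * (φ.time + 16) + 18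

variable {n : ℕ} {G : SimpleGraph (Fin n)} {B : Finset (Fin n)}

/-- The memory represents `G` and `B`, and the registers hold `n`, `n * n` and the valuation. -/
def Represents (G : SimpleGraph (Fin n)) (B : Finset (Fin n)) (ρ : ℕ → Fin n) (s : RamState) :
    Prop :=
  (∀ i j : Fin n, s.mem (i * n + j) ≠ 0 ↔ G.Adj i j) ∧
  (∀ i : Fin n, s.mem (n * n + n + i) ≠ 0 ↔ i ∈ B) ∧
  s.reg 0 = n ∧ s.reg 2 = n * n ∧
  ∀ i, s.reg (varReg i) = ρ i ∧ s.reg (rowReg i) = ρ i * n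

/-- The states agree up to the registers that a computation at depth `d` may change. -/
def SameUpTo (d : ℕ) (s s' : RamState) : Prop :=
  s'.mem = s.mem ∧ ∀ r, ¬ IsTemp d r → s'.reg r = s.reg r

theorem SameUpTo.refl (d : ℕ) (s : RamState) : SameUpTo d s s := ⟨rfl, fun _ _ => rfl⟩

theorem SameUpTo.trans {d : ℕ} {s s' s'' : RamState} (h : SameUpTo d s s')
    (h' : SameUpTo d s' s'') : SameUpTo d s s'' :=
  ⟨h'.1.trans h.1, fun r hr => (h'.2 r hr).trans (h.2 r hr)⟩

theorem SameUpTo.mono {d : ℕ} {s s' : RamState} (h : SameUpTo (d + 1) s s') : SameUpTo d s s' :=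
  ⟨h.1, fun r hr => h.2 r fun h' => hr ⟨by have := h'.1; omega, h'.2⟩⟩

theorem SameUpTo.represents {d : ℕ} {s s' : RamState} {ρ : ℕ → Fin n} (h : SameUpTo d s s')
    (hs : Represents G B ρ s) : Represents G B ρ s' := by
  obtain ⟨h1, h2, h3, h4, h5⟩ := hs
  refine ⟨by rw [h.1]; exact h1, by rw [h.1]; exact h2, ?_, ?_, fun i => ⟨?_, ?_⟩⟩
  · rw [h.2 _ (by simp [IsTemp]), h3]
  · rw [h.2 _ (by simp [IsTemp]), h4]
  · rw [h.2 _ (by simp only [IsTemp, varReg]; omega), (h5 i).1]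
  · rw [h.2 _ (by simp only [IsTemp, rowReg]; omega), (h5 i).2]

theorem SameUpTo.update {d r v : ℕ} {s : RamState} (hr : IsTemp d r) :
    SameUpTo d s ⟨Function.update s.reg r v, s.mem⟩ :=
  ⟨rfl, fun r' hr' => Function.update_of_ne (by rintro rfl; exact hr' hr) _ _⟩

theorem isTemp_outReg (d : ℕ) : IsTemp d (outReg d) := by simp only [IsTemp, outReg]; omega
theorem isTemp_saveReg (d : ℕ) : IsTemp d (saveReg d) := by simp only [IsTemp, saveReg]; omega
theorem isTemp_saveReg' (d : ℕ) : IsTemp d (saveReg' d) := by simp only [IsTemp, saveReg']; omega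

/-- The rule for `sweep`: `J x` holds before the value `x` is treated. -/
theorem Runs.sweep {i : ℕ} {c : RamProg} {N : ℕ} (J : ℕ → RamState → Prop)
    (hJ0 : ∀ x s, J x s → s.reg 0 = n)
    (hJu : ∀ x s a b, J x s →
      J x ⟨Function.update (Function.update s.reg (varReg i) a) (rowReg i) b, s.mem⟩)
    (hc : ∀ (x : Fin n) s, J x s → s.reg (varReg i) = x → s.reg (rowReg i) = x * n →
      Runs c s N fun s' => s'.reg (varReg i) = x ∧ s'.reg (rowReg i) = x * n ∧ J (x + 1) s')
    {s : RamState} (hs : J 0 s) :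
    Runs (sweep i c) s (n * (N + 12) + 8) (J n) := by
  have ne1 : varReg i ≠ rowReg i := by simp only [varReg, rowReg]; omega
  have ne0 : (0 : ℕ) ≠ varReg i := by simp only [varReg]; omega
  -- With `j` rounds left the current value is `n - j`. The row register is kept at `n` times that
  -- value by repeated addition, as the machine cannot multiply.
  let I : ℕ → RamState → Prop := fun j s => j ≤ n ∧ s.reg (varReg i) = n - j ∧
    s.reg (rowReg i) = (n - j) * n ∧ J (n - j) s
  refine Runs.mono (N := 2 + (2 + (n * ((N + (4 + 4)) + 3 + 1) + (3 + 1))))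
    (Runs.seq (Runs.assign (Runs.seq (Runs.assign (Runs.mono
      (Runs.loop (N := N + (4 + 4)) I ?_ ?_ n _ ?_) le_rfl ?_))))) (by ring_nf; omega) (fun _ h => h)
  · rintro j s ⟨hj, h1, h2, h3⟩
    have h0 := hJ0 _ _ h3
    refine ⟨by simp only [RamExpr.eval, h0, h1]; omega, Runs.seq ?_⟩
    refine Runs.mono (hc ⟨n - (j + 1), by omega⟩ s h3 h1 h2) le_rfl ?_
    rintro s' ⟨h1', h2', h3'⟩
    have h0' := hJ0 _ _ h3'
    refine Runs.seq (Runs.assign (Runs.assign ?_))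
    have e : n - j = n - (j + 1) + 1 := by omega
    refine ⟨by omega, ?_, ?_, ?_⟩
    · simp only [RamExpr.eval, Function.update_of_ne ne1, Function.update_self, h1']
      omega
    · simp only [RamExpr.eval, Function.update_of_ne ne1.symm, Function.update_self, h2',
        Function.update_of_ne ne0, h0']
      rw [e]; ring
    · rw [e]; exact hJu _ _ _ _ h3'
  · rintro s ⟨hj, h1, h2, h3⟩
    simp only [RamExpr.eval, hJ0 _ _ h3, h1]; omega
  · refine ⟨le_rfl, ?_, ?_, ?_⟩
    · simp [RamExpr.eval, Function.update_of_ne ne1]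
    · simp [RamExpr.eval]
    · simpa using hJu _ _ _ _ hs
  · rintro s' ⟨-, -, -, h⟩; simpa using h

/-- The states agree up to variable `i` and the registers that a computation at depth `d` may
change. -/
def SameUpToVar (i d : ℕ) (s s' : RamState) : Prop :=
  s'.mem = s.mem ∧ ∀ r, ¬ IsTemp d r → r ≠ varReg i → r ≠ rowReg i → s'.reg r = s.reg r

theorem SameUpToVar.represents {i d : ℕ} {s s' : RamState} {ρ : ℕ → Fin n} {x : Fin n}
    (h : SameUpToVar i d s s') (hs : Represents G B ρ s)
    (h1 : s'.reg (varReg i) = x) (h2 : s'.reg (rowReg i) = x * n) :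
    Represents G B (Function.update ρ i x) s' := by
  obtain ⟨a1, a2, a3, a4, a5⟩ := hs
  refine ⟨by rw [h.1]; exact a1, by rw [h.1]; exact a2, ?_, ?_, fun j => ?_⟩
  · rw [h.2 _ (by simp [IsTemp]) (by simp [varReg]) (by simp [rowReg]), a3]
  · rw [h.2 _ (by simp [IsTemp]) (by simp only [varReg]; omega) (by simp only [rowReg]; omega), a4]
  · by_cases hj : j = i
    · subst hj; simp [h1, h2]
    · rw [Function.update_of_ne hj]
      constructor
      · rw [h.2 _ (by simp only [IsTemp, varReg]; omega) (by simp only [varReg]; omega)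
          (by simp only [varReg, rowReg]; omega), (a5 j).1]
      · rw [h.2 _ (by simp only [IsTemp, rowReg]; omega) (by simp only [varReg, rowReg]; omega)
          (by simp only [rowReg]; omega), (a5 j).2]

theorem SameUpToVar.trans {i d : ℕ} {s s' s'' : RamState} (h : SameUpToVar i d s s')
    (h' : SameUpTo d s' s'') : SameUpToVar i d s s'' :=
  ⟨h'.1.trans h.1, fun r hr h1 h2 => (h'.2 r hr).trans (h.2 r hr h1 h2)⟩

theorem SameUpTo.toVar {d : ℕ} {s s' : RamState} (i : ℕ) (h : SameUpTo d s s') :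
    SameUpToVar i d s s' := ⟨h.1, fun r hr _ _ => h.2 r hr⟩

theorem SameUpToVar.update {i d : ℕ} {s s' : RamState} (h : SameUpToVar i d s s') (a b : ℕ) :
    SameUpToVar i d s ⟨Function.update (Function.update s'.reg (varReg i) a) (rowReg i) b, s'.mem⟩ :=
  ⟨h.1, fun r hr h1 h2 => by
    simp only [Function.update_of_ne h2, Function.update_of_ne h1, h.2 r hr h1 h2]⟩

/-- Induction on the formula. Variables occupy the registers congruent to 3 or 4 modulo 5, and
temporaries of depth `d` are registers from `5 * d + 5` on with the other residues. A subformula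
evaluated at depth `d + 1` thus leaves the output and save registers of depth `d` intact. A
quantifier overwrites its variable while sweeping and restores it from the save registers; each
costs a factor of about `n`, so the time is polynomial for a fixed formula. -/
theorem Form.runs_compile (φ : Form) : ∀ (d : ℕ) (ρ : ℕ → Fin n) (s : RamState),
    Represents G B ρ s → Runs (φ.compile d) s (φ.time.eval n) fun s' =>
      SameUpTo d s s' ∧ (s'.reg (outReg d) ≠ 0 ↔ φ.Realize G B ρ) := by
  induction φ with
  | adj i j =>
    intro d ρ s hs
    refine Runs.mono (Runs.assign ⟨SameUpTo.update (isTemp_outReg d), ?_⟩)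
      (by simp [Form.time, RamExpr.cost]) (fun _ h => h)
    simp only [Function.update_self, RamExpr.eval, (hs.2.2.2.2 _).1, (hs.2.2.2.2 _).2]
    exact hs.1 _ _
  | eq i j =>
    intro d ρ s hs
    refine Runs.mono (Runs.assign ⟨SameUpTo.update (isTemp_outReg d), ?_⟩)
      (by simp [Form.time, RamExpr.cost]) (fun _ h => h)
    -- The two truncated differences add up to zero exactly when the values agree.
    simp only [Function.update_self, RamExpr.eval, (hs.2.2.2.2 _).1, Form.Realize, Fin.ext_iff]
    omega
  | mem i =>
    intro d ρ s hs
    refine Runs.mono (Runs.assign ⟨SameUpTo.update (isTemp_outReg d), ?_⟩)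
      (by simp [Form.time, RamExpr.cost]) (fun _ h => h)
    simp only [Function.update_self, RamExpr.eval, (hs.2.2.2.2 _).1, hs.2.2.1, hs.2.2.2.1]
    exact hs.2.1 _
  | not φ ih =>
    intro d ρ s hs
    refine Runs.mono (Runs.seq (Runs.mono (ih (d + 1) ρ s hs) le_rfl ?_))
      (N := φ.time.eval n + 4) (by simp [Form.time]) (fun _ h => h)
    rintro s' ⟨h1, h2⟩
    refine Runs.assign ⟨h1.mono.trans (SameUpTo.update (isTemp_outReg d)), ?_⟩
    simp only [Function.update_self, RamExpr.eval, Form.Realize, ← h2]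
    omega
  | or φ ψ ih₁ ih₂ =>
    intro d ρ s hs
    refine Runs.mono (Runs.seq (Runs.mono (ih₁ (d + 1) ρ s hs) le_rfl ?_))
      (N := φ.time.eval n + (2 + (ψ.time.eval n + 4)))
      (by simp only [Form.time, Polynomial.eval_add, Polynomial.eval_ofNat]; omega) (fun _ h => h)
    rintro s' ⟨h1, h2⟩
    refine Runs.seq (Runs.assign (Runs.seq ?_))
    have h3 := h1.mono.trans (SameUpTo.update (v := s'.reg (outReg (d + 1))) (isTemp_outReg d))
    refine Runs.mono (ih₂ (d + 1) ρ _ (h3.represents hs)) le_rfl ?_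
    rintro s'' ⟨h4, h5⟩
    refine Runs.assign ⟨(h3.trans h4.mono).trans (SameUpTo.update (isTemp_outReg d)), ?_⟩
    have h6 : s''.reg (outReg d) = s'.reg (outReg (d + 1)) := by
      rw [h4.2 _ (by simp only [IsTemp, outReg]; omega)]; simp [RamExpr.eval]
    simp only [Function.update_self, RamExpr.eval, Form.Realize, ← h2, ← h5, h6]
    omega
  | ex i φ ih =>
    intro d ρ s hs
    have nv (d) : varReg i ≠ outReg d := by simp only [varReg, outReg]; omega
    have nr (d) : rowReg i ≠ outReg d := by simp only [rowReg, outReg]; omega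
    -- The output register accumulates the truth values for all `y < x`, so it is non-zero once a
    -- witness has been seen.
    let J : ℕ → RamState → Prop := fun x s' => SameUpToVar i d s s' ∧
      s'.reg (saveReg d) = ρ i ∧ s'.reg (saveReg' d) = ρ i * n ∧
      (s'.reg (outReg d) ≠ 0 ↔ ∃ y : Fin n, (y : ℕ) < x ∧ φ.Realize G B (Function.update ρ i y))
    refine Runs.mono (N := 2 + (2 + (2 + ((n * (φ.time.eval n + 4 + 12) + 8) + (2 + 2)))))
      (Runs.seq (Runs.assign (Runs.seq (Runs.assign (Runs.seq (Runs.assign (Runs.seq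
        (Runs.mono (Runs.sweep (n := n) (N := φ.time.eval n + 4) J ?_ ?_ ?_ ?_) le_rfl ?_))))))))
      (by simp only [Form.time, Polynomial.eval_add, Polynomial.eval_mul, Polynomial.eval_X,
            Polynomial.eval_ofNat]; ring_nf; omega) (fun _ h => h)
    · rintro x s' ⟨h, -⟩
      rw [h.2 _ (by simp [IsTemp]) (by simp [varReg]) (by simp [rowReg])]; exact hs.2.2.1
    · rintro x s' a b ⟨h1, h2, h3, h4⟩
      refine ⟨h1.update a b, ?_, ?_, ?_⟩
      · rw [← h2]; simp only [varReg, rowReg, saveReg]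
        rw [Function.update_of_ne (by omega), Function.update_of_ne (by omega)]
      · rw [← h3]; simp only [varReg, rowReg, saveReg']
        rw [Function.update_of_ne (by omega), Function.update_of_ne (by omega)]
      · rw [← h4]; simp only
        rw [Function.update_of_ne (nr d).symm, Function.update_of_ne (nv d).symm]
    · rintro x s' ⟨h1, h2, h3, h4⟩ h5 h6
      refine Runs.seq (Runs.mono (ih (d + 1) _ _ (h1.represents hs h5 h6)) le_rfl ?_)
      rintro s'' ⟨h7, h8⟩
      have h9 := h1.trans (h7.mono.trans (SameUpTo.update (v := s''.reg (outReg d) +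
        s''.reg (outReg (d + 1))) (isTemp_outReg d)))
      refine Runs.assign ⟨?_, ?_, h9, ?_, ?_, ?_⟩
      · simp only [Function.update_of_ne (nv d)]
        rw [h7.2 _ (by simp only [IsTemp, varReg]; omega), h5]
      · simp only [Function.update_of_ne (nr d)]
        rw [h7.2 _ (by simp only [IsTemp, rowReg]; omega), h6]
      · rw [← h2, ← h7.2 (saveReg d) (by simp only [IsTemp, saveReg]; omega)]
        exact Function.update_of_ne (by simp only [saveReg, outReg]; omega) _ _
      · rw [← h3, ← h7.2 (saveReg' d) (by simp only [IsTemp, saveReg']; omega)]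
        exact Function.update_of_ne (by simp only [saveReg', outReg]; omega) _ _
      · simp only [Function.update_self, RamExpr.eval]
        have h10 : s''.reg (outReg d) = s'.reg (outReg d) :=
          h7.2 _ (by simp only [IsTemp, outReg]; omega)
        rw [h10]
        have : (∃ y : Fin n, (y : ℕ) < x + 1 ∧ φ.Realize G B (Function.update ρ i y)) ↔
            (∃ y : Fin n, (y : ℕ) < x ∧ φ.Realize G B (Function.update ρ i y)) ∨
            φ.Realize G B (Function.update ρ i x) := by
          constructor
          · rintro ⟨y, hy, h⟩
            rcases Nat.lt_succ_iff_lt_or_eq.1 hy with h' | h'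
            · exact Or.inl ⟨y, h', h⟩
            · exact Or.inr (Fin.ext h' ▸ h)
          · rintro (⟨y, hy, h⟩ | h)
            · exact ⟨y, by omega, h⟩
            · exact ⟨x, by omega, h⟩
        rw [this, ← h4, ← h8]
        omega
    · simp only [RamExpr.eval]
      have e1 : saveReg' d ≠ outReg d := by simp only [saveReg', outReg]; omega
      have e2 : saveReg d ≠ outReg d := by simp only [saveReg, outReg]; omega
      have e3 : saveReg d ≠ saveReg' d := by simp only [saveReg, saveReg']; omega
      have e4 : rowReg i ≠ saveReg d := by simp only [rowReg, saveReg]; omega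
      refine ⟨SameUpTo.toVar i (((SameUpTo.update (isTemp_saveReg d)).trans
        (SameUpTo.update (isTemp_saveReg' d))).trans (SameUpTo.update (isTemp_outReg d))), ?_, ?_, ?_⟩
      · simp [Function.update_of_ne e2, Function.update_of_ne e3, (hs.2.2.2.2 i).1]
      · simp [Function.update_of_ne e1, Function.update_of_ne e4, (hs.2.2.2.2 i).2]
      · simp
    · rintro s' ⟨h1, h2, h3, h4⟩
      refine Runs.seq (Runs.assign (Runs.assign ⟨⟨h1.1, fun r hr => ?_⟩, ?_⟩))
      · simp only [RamExpr.eval]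
        by_cases hr2 : r = rowReg i
        · subst hr2
          rw [Function.update_self, Function.update_of_ne
            (by simp only [saveReg', varReg]; omega), h3, (hs.2.2.2.2 i).2]
        · rw [Function.update_of_ne hr2]
          by_cases hr1 : r = varReg i
          · subst hr1; rw [Function.update_self, h2, (hs.2.2.2.2 i).1]
          · rw [Function.update_of_ne hr1, h1.2 r hr hr1 hr2]
      · simp only
        rw [Function.update_of_ne (nr d).symm, Function.update_of_ne (nv d).symm, h4]
        simp [Form.Realize]

/-- Set variable `i` to a value that makes `φ` true, if there is one. -/
def Form.find (i : ℕ) (φ : Form) : RamProg :=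
  .seq (sweep i (.seq (φ.compile 1) (.ite (.reg (outReg 1))
    (.seq (.assign (saveReg 0) (.reg (varReg i))) (.assign (saveReg' 0) (.reg (rowReg i))))
    -- A dummy instruction: the language has no empty program.
    (.assign (outReg 0) (.const 0))))) <|
  .seq (.assign (varReg i) (.reg (saveReg 0))) (.assign (rowReg i) (.reg (saveReg' 0)))

/-- The sweep overwrites the save registers of depth 0 at each success, so they end up holding the
last witness. The formula is compiled at depth 1 in order not to touch them. -/
theorem Form.runs_find (i : ℕ) (φ : Form) (ρ : ℕ → Fin n) (s : RamState) (hs : Represents G B ρ s)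
    (hex : ∃ x, φ.Realize G B (Function.update ρ i x)) :
    Runs (φ.find i) s ((Polynomial.X * (φ.time + 18) + 12).eval n) fun s' =>
      ∃ x, φ.Realize G B (Function.update ρ i x) ∧ Represents G B (Function.update ρ i x) s' ∧
        s'.mem = s.mem ∧ s'.reg 1 = s.reg 1 := by
  let J : ℕ → RamState → Prop := fun x s' => SameUpToVar i 0 s s' ∧
    ((∃ y : Fin n, (y : ℕ) < x ∧ φ.Realize G B (Function.update ρ i y)) →
      ∃ y : Fin n, φ.Realize G B (Function.update ρ i y) ∧
        s'.reg (saveReg 0) = y ∧ s'.reg (saveReg' 0) = y * n)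
  refine Runs.mono (N := (n * (φ.time.eval n + (2 + 4) + 12) + 8) + (2 + 2))
    (Runs.seq (Runs.mono (Runs.sweep (n := n) (N := φ.time.eval n + (2 + 4)) J ?_ ?_ ?_ ?_) le_rfl ?_))
    (by simp only [Polynomial.eval_add, Polynomial.eval_mul, Polynomial.eval_X,
            Polynomial.eval_ofNat]; ring_nf; omega) (fun _ h => h)
  · rintro x s' ⟨h, -⟩
    rw [h.2 _ (by simp [IsTemp]) (by simp [varReg]) (by simp [rowReg])]; exact hs.2.2.1
  · rintro x s' a b ⟨h1, h2⟩
    refine ⟨h1.update a b, fun h => ?_⟩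
    obtain ⟨y, hy, h3, h4⟩ := h2 h
    refine ⟨y, hy, ?_, ?_⟩
    · rw [← h3]; simp only [varReg, rowReg, saveReg]
      rw [Function.update_of_ne (by omega), Function.update_of_ne (by omega)]
    · rw [← h4]; simp only [varReg, rowReg, saveReg']
      rw [Function.update_of_ne (by omega), Function.update_of_ne (by omega)]
  · rintro x s' ⟨h1, h2⟩ h5 h6
    refine Runs.seq (Runs.mono (φ.runs_compile 1 _ _ (h1.represents hs h5 h6)) le_rfl ?_)
    rintro s'' ⟨h7, h8⟩
    have h9 := h1.trans h7.mono
    have h5' : s''.reg (varReg i) = x := by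
      rw [h7.2 _ (by simp only [IsTemp, varReg]; omega), h5]
    have h6' : s''.reg (rowReg i) = x * n := by
      rw [h7.2 _ (by simp only [IsTemp, rowReg]; omega), h6]
    refine Runs.ite (fun ht => ?_) (fun ht => ?_)
    · refine Runs.seq (Runs.assign (Runs.assign ⟨?_, ?_, ?_, fun _ => ⟨x, h8.1 ht, ?_, ?_⟩⟩))
      · simp only [varReg, saveReg, saveReg'] at *
        rw [Function.update_of_ne (by omega), Function.update_of_ne (by omega), h5']
      · simp only [rowReg, saveReg, saveReg'] at *
        rw [Function.update_of_ne (by omega), Function.update_of_ne (by omega), h6']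
      · exact h9.trans ((SameUpTo.update (isTemp_saveReg 0)).trans
          (SameUpTo.update (isTemp_saveReg' 0)))
      · simp only [RamExpr.eval]
        rw [Function.update_of_ne (by simp [saveReg, saveReg']), Function.update_self, h5']
      · simp only [RamExpr.eval]
        rw [Function.update_self, Function.update_of_ne (by simp only [rowReg, saveReg]; omega), h6']
    · refine Runs.mono (Runs.assign ⟨?_, ?_, ?_, ?_⟩) (by simp [RamExpr.cost]) (fun _ h => h)
      · simp only [varReg, outReg] at *
        rw [Function.update_of_ne (by omega), h5']
      · simp only [rowReg, outReg] at *
        rw [Function.update_of_ne (by omega), h6']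
      · exact h9.trans (SameUpTo.update (isTemp_outReg 0))
      · rintro ⟨y, hy, hy'⟩
        have hyx : (y : ℕ) < x := by
          rcases Nat.lt_succ_iff_lt_or_eq.1 hy with h' | h'
          · exact h'
          · exact absurd (h8.2 (Fin.ext h' ▸ hy')) (not_not.2 ht)
        obtain ⟨z, hz, h3, h4⟩ := h2 ⟨y, hyx, hy'⟩
        refine ⟨z, hz, ?_, ?_⟩
        · have e : saveReg 0 ≠ outReg 0 := by decide
          simp only [Function.update_of_ne e]
          rw [h7.2 (saveReg 0) (by simp [IsTemp, saveReg]), h3]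
        · have e : saveReg' 0 ≠ outReg 0 := by decide
          simp only [Function.update_of_ne e]
          rw [h7.2 (saveReg' 0) (by simp [IsTemp, saveReg']), h4]
  · exact ⟨SameUpTo.toVar i (SameUpTo.refl 0 s), by simp⟩
  · rintro s' ⟨h1, h2⟩
    obtain ⟨x, hx⟩ := hex
    obtain ⟨y, hy, h3, h4⟩ := h2 ⟨x, x.2, hx⟩
    refine Runs.seq (Runs.assign (Runs.assign ⟨y, hy, ?_, h1.1, ?_⟩))
    · refine (h1.update _ _).represents hs ?_ ?_
      · simp only [RamExpr.eval]
        rw [Function.update_of_ne (by simp only [varReg, rowReg]; omega), Function.update_self, h3]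
      · simp only [RamExpr.eval]
        rw [Function.update_self, Function.update_of_ne (by simp only [saveReg', varReg]; omega), h4]
    · simp only
      rw [Function.update_of_ne (by simp only [rowReg]; omega),
        Function.update_of_ne (by simp only [varReg]; omega),
        h1.2 1 (by simp [IsTemp]) (by simp only [varReg]; omega) (by simp only [rowReg]; omega)]

/-- Compute `n * n` in register `2`, find an edge satisfying `φ` and delete it. -/
def Form.deleteEdge (φ : Form) : RamProg :=
  .seq (sweep 0 (.assign 2 (.add (.reg 2) (.reg 0)))) <|
  .seq (.assign (varReg 0) (.const 0)) <| .seq (.assign (rowReg 0) (.const 0)) <|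
  .seq ((Form.ex 1 φ).find 0) <| .seq (φ.find 1) <|
  .seq (.store (.add (.reg (rowReg 0)) (.reg (varReg 1))) (.const 0))
    (.store (.add (.reg (rowReg 1)) (.reg (varReg 0))) (.const 0))

theorem mul_add_eq_iff (i j i' j' : Fin n) :
    (i : ℕ) * n + j = i' * n + j' ↔ i = i' ∧ j = j' := by
  constructor
  · intro h
    have hn : 0 < n := i.pos
    have h1 : ((i : ℕ) * n + j) / n = (i' * n + j') / n := by rw [h]
    have h2 : ((i : ℕ) * n + j) % n = (i' * n + j') % n := by rw [h]
    rw [Nat.mul_comm (i : ℕ), Nat.mul_comm (i' : ℕ), Nat.mul_add_div hn, Nat.mul_add_div hn,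
      Nat.div_eq_of_lt j.2, Nat.div_eq_of_lt j'.2] at h1
    rw [Nat.mul_comm (i : ℕ), Nat.mul_comm (i' : ℕ), Nat.mul_add_mod, Nat.mul_add_mod,
      Nat.mod_eq_of_lt j.2, Nat.mod_eq_of_lt j'.2] at h2
    exact ⟨Fin.ext (by omega), Fin.ext h2⟩
  · rintro ⟨rfl, rfl⟩; rfl

theorem mul_add_lt (i j : Fin n) : (i : ℕ) * n + j < n * n := by
  have := Nat.mul_le_mul_right n (Nat.succ_le_of_lt i.2)
  have := j.2
  rw [Nat.succ_mul] at *
  omega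

theorem inputState_adj (t : ℕ) (X B : Finset (Fin n)) (i j : Fin n) :
    ((inputState G t X B).mem (i * n + j) = 1 ∧ G.Adj i j) ∨
      ((inputState G t X B).mem (i * n + j) = 0 ∧ ¬ G.Adj i j) := by
  have hlt := mul_add_lt i j
  simp only [inputState]
  by_cases h : G.Adj i j
  · exact Or.inl ⟨if_pos (Or.inl ⟨i, j, h, rfl⟩), h⟩
  · refine Or.inr ⟨if_neg ?_, h⟩
    rintro (⟨i', j', h', e⟩ | ⟨i', _, e⟩ | ⟨i', _, e⟩)
    · obtain ⟨rfl, rfl⟩ := (mul_add_eq_iff _ _ _ _).1 e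
      exact h h'
    · omega
    · omega

theorem inputState_mem (t : ℕ) (X B : Finset (Fin n)) (i : Fin n) :
    (inputState G t X B).mem (n * n + n + i) ≠ 0 ↔ i ∈ B := by
  simp only [inputState]
  constructor
  · intro h
    by_contra hi
    refine h (if_neg ?_)
    rintro (⟨i', j', h', e⟩ | ⟨i', _, e⟩ | ⟨i', hB, e⟩)
    · have := mul_add_lt i' j'
      omega
    · have := i'.2
      omega
    · obtain rfl : i = i' := Fin.ext (by omega)
      exact hi hB
  · intro h
    rw [if_pos (Or.inr (Or.inr ⟨i, h, rfl⟩))]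
    exact one_ne_zero

open Classical in
/-- A first-order definable choice of edges can be made, and the edge deleted, in polynomial
time. -/
theorem exists_prog_deleteEdge (φ : Form) :
    ∃ (prog : RamProg) (bound : Polynomial ℕ),
      ∀ (n : ℕ) (G : SimpleGraph (Fin n)) (t : ℕ) (X B : Finset (Fin n)),
        (∃ ρ : ℕ → Fin n, φ.Realize G B ρ) →
        (∀ ρ ρ' : ℕ → Fin n, ρ 0 = ρ' 0 → ρ 1 = ρ' 1 → φ.Realize G B ρ → φ.Realize G B ρ') →
        ∃ (k : ℕ) (s : RamState) (ρ : ℕ → Fin n),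
          k ≤ bound.eval n ∧ Exec prog (inputState G t X B) k s ∧
          φ.Realize G B ρ ∧ HoldsInstance s (G.deleteEdges {s(ρ 0, ρ 1)}) t := by
  refine ⟨φ.deleteEdge, Polynomial.X * 16 + 8 + (2 + (2 +
    ((Polynomial.X * ((Form.ex 1 φ).time + 18) + 12) + ((Polynomial.X * (φ.time + 18) + 12) +
      (5 + 5))))), ?_⟩
  intro n G t X B ⟨ρ₁, hρ₁⟩ hφ
  have hn : 0 < n := (ρ₁ 0).pos
  set s₀ := inputState G t X B with hs₀
  let ρ₀ : ℕ → Fin n := fun _ => ⟨0, hn⟩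
  suffices h : Runs φ.deleteEdge s₀ _ fun s => ∃ ρ : ℕ → Fin n, φ.Realize G B ρ ∧
      HoldsInstance s (G.deleteEdges {s(ρ 0, ρ 1)}) t by
    obtain ⟨k, s, h1, h2, ρ, h3, h4⟩ := h
    exact ⟨k, s, ρ, h2, h1, h3, h4⟩
  -- Register 2 gains `n` in every round of the first sweep, hence holds `n * n` at its end.
  let J : ℕ → RamState → Prop := fun x s => s.mem = s₀.mem ∧ s.reg 2 = x * n ∧
    ∀ r, r ≠ 2 → r ≠ varReg 0 → r ≠ rowReg 0 → s.reg r = s₀.reg r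
  refine Runs.mono (N := (n * (4 + 12) + 8) + (2 + (2 + (((Polynomial.X *
    ((Form.ex 1 φ).time + 18) + 12).eval n) + (((Polynomial.X * (φ.time + 18) + 12).eval n) +
      (5 + 5)))))) (Runs.seq (Runs.mono (Runs.sweep (n := n) (N := 4) J ?_ ?_ ?_ ?_) le_rfl ?_))
    (by simp only [Polynomial.eval_add, Polynomial.eval_mul, Polynomial.eval_X,
            Polynomial.eval_ofNat]; omega) (fun _ h => h)
  · rintro x s ⟨-, -, h⟩
    rw [h 0 (by simp) (by simp [varReg]) (by simp [rowReg])]; simp [hs₀, inputState]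
  · rintro x s a b ⟨h1, h2, h3⟩
    refine ⟨h1, ?_, fun r hr1 hr2 hr3 => ?_⟩
    · rw [← h2]; simp [varReg, rowReg]
    · simp only [Function.update_of_ne hr3, Function.update_of_ne hr2, h3 r hr1 hr2 hr3]
  · rintro x s ⟨h1, h2, h3⟩ h4 h5
    refine Runs.assign ⟨?_, ?_, h1, ?_, fun r hr1 hr2 hr3 => ?_⟩
    · rw [← h4]; simp [varReg]
    · rw [← h5]; simp [rowReg]
    · have : s.reg 0 = n := by
        rw [h3 0 (by simp) (by simp [varReg]) (by simp [rowReg])]; simp [hs₀, inputState]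
      simp only [RamExpr.eval, Function.update_self, h2, this]; ring
    · simp only [Function.update_of_ne hr1, h3 r hr1 hr2 hr3]
  · exact ⟨rfl, by simp [hs₀, inputState], fun _ _ _ _ => rfl⟩
  · rintro s ⟨h1, h2, h3⟩
    refine Runs.seq (Runs.assign (Runs.seq (Runs.assign (Runs.seq ?_))))
    -- The sweep has run variable 0 past the last vertex. After the reset all variable registers are
    -- zero, which encodes the constant valuation with value vertex 0.
    have hrep : Represents G B ρ₀ ⟨Function.update (Function.update s.reg (varReg 0) 0) (rowReg 0) 0,
        s.mem⟩ := by
      refine ⟨fun i j => ?_, fun i => ?_, ?_, ?_, fun i => ?_⟩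
      · simp only [h1]
        rcases inputState_adj (G := G) t X B i j with h | h <;> simp [hs₀, h]
      · simp only [h1]
        exact inputState_mem t X B i
      · simp only [varReg, rowReg]
        rw [Function.update_of_ne (by simp), Function.update_of_ne (by simp),
          h3 0 (by simp) (by simp [varReg]) (by simp [rowReg])]; simp [hs₀, inputState]
      · rw [← h2]; simp [varReg, rowReg]
      · have aux (r : ℕ) (hr : 3 ≤ r) : Function.update (Function.update s.reg (varReg 0) 0)
            (rowReg 0) 0 r = 0 := by
          by_cases hr2 : r = rowReg 0
          · subst hr2; simp
          · rw [Function.update_of_ne hr2]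
            by_cases hr1 : r = varReg 0
            · subst hr1; simp
            · rw [Function.update_of_ne hr1, h3 r (by omega) hr1 hr2]
              simp only [hs₀, inputState]
              rw [if_neg (by omega), if_neg (by omega)]
        refine ⟨?_, ?_⟩
        · simp only [ρ₀]; exact aux _ (by simp [varReg])
        · simp only [ρ₀, Nat.zero_mul]; exact aux _ (by simp only [rowReg]; omega)
    -- The search starts from the constant valuation, to which the given witness transfers because
    -- the truth of `φ` depends on variables 0 and 1 only.
    have hex : ∃ x, (Form.ex 1 φ).Realize G B (Function.update ρ₀ 0 x) :=
      ⟨ρ₁ 0, ρ₁ 1, hφ ρ₁ _ (by simp) (by simp) hρ₁⟩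
    refine Runs.mono (Form.runs_find 0 _ ρ₀ _ hrep hex) le_rfl ?_
    rintro s' ⟨x, hx, hrep', hm', h1'⟩
    refine Runs.seq (Runs.mono (Form.runs_find 1 φ _ _ hrep' hx) le_rfl ?_)
    rintro s'' ⟨y, hy, hrep'', hm'', h1''⟩
    refine Runs.seq (Runs.store (Runs.store ⟨_, hy, hrep''.2.2.1, ?_, fun i j => ?_⟩))
    · simp only [h1'', h1']
      rw [Function.update_of_ne (by simp [rowReg]), Function.update_of_ne (by simp [varReg]),
        h3 1 (by simp) (by simp [varReg]) (by simp [rowReg])]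
      simp [hs₀, inputState]
    · simp only [RamExpr.eval, (hrep''.2.2.2.2 _).1, (hrep''.2.2.2.2 _).2, hm'', hm', h1]
      simp only [Function.update_self, ne_eq, zero_ne_one, not_false_eq_true,
        Function.update_of_ne]
      have := inputState_adj (G := G) t X B i j
      simp only [Function.update_apply, mul_add_eq_iff, SimpleGraph.deleteEdges_adj,
        Set.mem_singleton_iff, Sym2.eq_iff]
      by_cases c1 : i = y ∧ j = x
      · rw [if_pos c1, if_neg (by rintro ⟨-, h⟩; exact h (Or.inr c1))]
      · rw [if_neg c1]
        by_cases c2 : i = x ∧ j = y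
        · rw [if_pos c2, if_neg (by rintro ⟨-, h⟩; exact h (Or.inl c2))]
        · rw [if_neg c2]
          rcases this with h | h
          · rw [if_pos ⟨h.2, by tauto⟩]; exact h.1
          · rw [if_neg (fun h' => h.2 h'.1)]; exact h.1

end Compile

/-! ### Connectedness and closed sets -/

section Connectivity

variable {V : Type*} {G : SimpleGraph V}

/-- Connectivity is handled through sets closed under adjacency instead of walks. This is the
induction principle for a connected set, and `preconnected_of_closed` is its converse. -/
theorem subset_of_closed {S U : Set V} (h : (G.induce S).Preconnected) {a : V} (haS : a ∈ S)
    (haU : a ∈ U) (hU : ∀ u ∈ S, u ∈ U → ∀ v ∈ S, G.Adj u v → v ∈ U) : S ⊆ U := by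
  intro b hb
  obtain ⟨w⟩ := h ⟨a, haS⟩ ⟨b, hb⟩
  suffices ∀ (x y : S) (w : (G.induce S).Walk x y), (x : V) ∈ U → (y : V) ∈ U from
    this _ _ w haU
  intro x y w
  induction w with
  | nil => exact id
  | cons hadj _ ih => exact fun hx => ih (hU _ (Subtype.prop _) hx _ (Subtype.prop _) hadj)

theorem preconnected_of_closed {S : Set V}
    (h : ∀ (U : Set V) (a : V), a ∈ S → a ∈ U →
      (∀ u ∈ S, u ∈ U → ∀ v ∈ S, G.Adj u v → v ∈ U) → S ⊆ U) : (G.induce S).Preconnected := by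
  rintro ⟨a, ha⟩ ⟨b, hb⟩
  obtain ⟨_, h'⟩ := h {b | ∃ hb : b ∈ S, (G.induce S).Reachable ⟨a, ha⟩ ⟨b, hb⟩} a ha
    ⟨ha, SimpleGraph.Reachable.refl _⟩
    (fun u hu ⟨_, hr⟩ v hv hadj => ⟨hv, hr.trans (SimpleGraph.Adj.reachable (by exact hadj))⟩) hb
  exact h'

theorem connected_of_closed {S : Set V} (hne : S.Nonempty)
    (h : ∀ (U : Set V) (a : V), a ∈ S → a ∈ U →
      (∀ u ∈ S, u ∈ U → ∀ v ∈ S, G.Adj u v → v ∈ U) → S ⊆ U) : (G.induce S).Connected :=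
  haveI := hne.to_subtype
  SimpleGraph.Connected.mk (preconnected_of_closed h)

/-- The vertices that can be reached from `a` inside `S`. -/
def componentIn (G : SimpleGraph V) (S : Set V) (a : V) : Set V :=
  {b | Relation.ReflTransGen (fun u v => G.Adj u v ∧ v ∈ S) a b}

theorem mem_componentIn_self {S : Set V} (a : V) : a ∈ componentIn G S a := Relation.ReflTransGen.refl

theorem componentIn_subset {S : Set V} {a : V} (ha : a ∈ S) : componentIn G S a ⊆ S := by
  intro b hb
  induction hb with
  | refl => exact ha
  | tail _ h _ => exact h.2

theorem componentIn_closed {S : Set V} {a u v : V} (hu : u ∈ componentIn G S a) (hv : v ∈ S)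
    (h : G.Adj u v) : v ∈ componentIn G S a := Relation.ReflTransGen.tail hu ⟨h, hv⟩

theorem componentIn_subset_of_closed {S U : Set V} {a : V} (ha : a ∈ S) (haU : a ∈ U)
    (hU : ∀ u ∈ S, u ∈ U → ∀ v ∈ S, G.Adj u v → v ∈ U) : componentIn G S a ⊆ U := by
  intro b hb
  induction hb with
  | refl => exact haU
  | tail h1 h ih => exact hU _ (componentIn_subset ha h1) ih _ h.2 h.1

theorem componentIn_connected {S : Set V} {a : V} (ha : a ∈ S) :
    (G.induce (componentIn G S a)).Connected := by
  refine connected_of_closed ⟨a, mem_componentIn_self a⟩ fun U c hc hcU hU => ?_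
  have back : ∀ b ∈ componentIn G S a, b ∈ U → a ∈ U := by
    intro b hb
    induction hb with
    | refl => exact id
    | tail h1 h ih => exact fun hb => ih (hU _ (componentIn_closed h1 h.2 h.1) hb _ h1 h.1.symm)
  intro b hb
  have := componentIn_subset_of_closed (U := {b | b ∈ componentIn G S a ∧ b ∈ U}) ha
    ⟨mem_componentIn_self a, back c hc hcU⟩
    (fun u _ hu v hv hadj => ⟨componentIn_closed hu.1 hv hadj,
      hU u hu.1 hu.2 v (componentIn_closed hu.1 hv hadj) hadj⟩) hb
  exact this.2

/-- A graph without cut vertices: a vertex set whose neighbours outside it are all equal to `a`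
contains every vertex other than `a`. -/
def NoCutVertex (G : SimpleGraph V) : Prop :=
  ∀ (S : Set V) (a : V), (∃ u ∈ S, u ≠ a) → (∀ u ∈ S, ∀ v, G.Adj u v → v ∈ S ∨ v = a) →
    ∀ v, v ∈ S ∨ v = a

/-- A connected graph has one component, so deleting a non-articulation vertex `a` leaves at most
one. The given set is closed under adjacency in `G - a`, hence is everything there. -/
theorem IsBiconnected.noCutVertex [Finite V] (h : IsBiconnected G) : NoCutVertex G := by
  intro S a ⟨u, hu, hua⟩ hS v
  have h1 := h.2 a
  simp only [IsArticulationVertex, not_lt] at h1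
  have : Nonempty V := ⟨a⟩
  have hc : Nat.card G.ConnectedComponent = 1 := by
    have := h.1.preconnected.subsingleton_connectedComponent
    exact Nat.card_eq_one_iff_unique.2 ⟨this, ⟨G.connectedComponentMk a⟩⟩
  rw [hc] at h1
  have hss : Subsingleton (G.induce {a}ᶜ).ConnectedComponent := Finite.card_le_one_iff_subsingleton.1 h1
  have hpc : (G.induce ({a}ᶜ : Set V)).Preconnected := fun x y =>
    SimpleGraph.ConnectedComponent.exact (Subsingleton.elim _ _)
  by_cases hv : v = a
  · exact Or.inr hv
  · refine Or.inl (subset_of_closed (U := S) hpc (a := u) hua hu ?_ hv)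
    intro x _ hx y hy hxy
    exact (hS x hx y hxy).resolve_right hy

theorem NoCutVertex.induce_compl_preconnected (h : NoCutVertex G) (a : V) :
    (G.induce ({a}ᶜ : Set V)).Preconnected := by
  refine preconnected_of_closed fun U b hb hbU hU v hv => ?_
  refine ((h (U ∩ {a}ᶜ) a ⟨b, ⟨hbU, hb⟩, hb⟩ ?_ v).resolve_right hv).1
  intro x hx y hxy
  by_cases hy : y = a
  · exact Or.inr hy
  · exact Or.inl ⟨hU x hx.2 hx.1 y hy hxy, hy⟩

end Connectivity

/-! ### Treewidth and minors -/

section Minors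

variable {V W : Type*} {G : SimpleGraph V}

open Classical in
/-- If `H` has a minor model in `G[Y]`, with branch set `br w` for `w`, then `tw(H) ≤ tw(G[Y])`. -/
theorem TreewidthAtMost.of_branchSets [Finite W] {H : SimpleGraph W} {Y : Set V} {k : ℕ}
    (hG : TreewidthAtMost (G.induce Y) k) (br : W → Set V) (hsub : ∀ w, br w ⊆ Y)
    (hconn : ∀ w, (G.induce (br w)).Connected)
    (hdisj : ∀ w w' u, u ∈ br w → u ∈ br w' → w = w')
    (hadj : ∀ w w', H.Adj w w' → ∃ u ∈ br w, ∃ u' ∈ br w', G.Adj u u') :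
    TreewidthAtMost H k := by
  obtain ⟨ι, hι, T, χ, hT⟩ := hG
  have := Fintype.ofFinite W
  -- The tree is kept; the new bag of a node consists of all `w` whose branch set meets the old bag.
  refine ⟨ι, hι, T, fun b => Finset.univ.filter fun w => ∃ u ∈ χ b, (u : V) ∈ br w, hT.isTree,
    fun w => ?_, fun w w' h => ?_, fun w => ?_, fun b => ?_⟩
  · obtain ⟨u, hu⟩ := (hconn w).nonempty
    obtain ⟨b, hb⟩ := hT.vertex_covered ⟨u, hsub w hu⟩
    exact ⟨b, by simpa using ⟨u, ⟨hsub w hu, hb⟩, hu⟩⟩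
  · obtain ⟨u, hu, u', hu', h⟩ := hadj w w' h
    obtain ⟨b, hb, hb'⟩ := hT.edge_covered ⟨u, hsub w hu⟩ ⟨u', hsub w' hu'⟩ h
    refine ⟨b, ?_, ?_⟩
    · simpa using ⟨u, ⟨hsub w hu, hb⟩, hu⟩
    · simpa using ⟨u', ⟨hsub w' hu', hb'⟩, hu'⟩
  · obtain ⟨u₀, hu₀⟩ := (hconn w).nonempty
    obtain ⟨b₀, hb₀⟩ := hT.vertex_covered ⟨u₀, hsub w hu₀⟩
    refine connected_of_closed ⟨b₀, by simpa using ⟨u₀, ⟨hsub w hu₀, hb₀⟩, hu₀⟩⟩ ?_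
    intro U a ha haU hU
    have key : ∀ (u : Y), (u : V) ∈ br w → ∀ b, u ∈ χ b → b ∈ U → ∀ b', u ∈ χ b' → b' ∈ U := by
      intro u hu b hb hbU b' hb'
      refine subset_of_closed (S := {b | u ∈ χ b}) (hT.connected u).preconnected hb hbU ?_ hb'
      intro c hc hcU c' hc' h
      refine hU c ?_ hcU c' ?_ h
      · simpa using ⟨u, ⟨u.2, hc⟩, hu⟩
      · simpa using ⟨u, ⟨u.2, hc'⟩, hu⟩
    obtain ⟨u₁, hu₁, hu₁'⟩ : ∃ u ∈ χ a, (u : V) ∈ br w := by simpa using ha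
    -- The nodes of `w` are the union of the subtrees of the vertices of its branch set. Subtrees of
    -- adjacent vertices share a node, so connectedness of the branch set passes to the union.
    have all : br w ⊆ {u | ∀ (hu : u ∈ Y) (b : ι), ⟨u, hu⟩ ∈ χ b → b ∈ U} := by
      refine subset_of_closed (hconn w).preconnected hu₁' (fun _ b hb => key u₁ hu₁' a hu₁ haU b hb) ?_
      intro u hu huU v hv huv hvY b hb
      obtain ⟨c, hc, hc'⟩ := hT.edge_covered ⟨u, hsub w hu⟩ ⟨v, hvY⟩ huv
      exact key _ hv c hc' (huU _ c hc) b hb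
    intro b hb
    obtain ⟨u, hu, hu'⟩ : ∃ u ∈ χ b, (u : V) ∈ br w := by simpa using hb
    exact all hu' _ b hu
  -- Choosing for every `w` in the new bag a representative in the old one is injective, as branch
  -- sets are disjoint. Outside the new bag the choice is arbitrary.
  · have hex : ∀ w : W, ∃ u : Y, (∃ u ∈ χ b, (u : V) ∈ br w) → u ∈ χ b ∧ (u : V) ∈ br w := by
      intro w
      by_cases h : ∃ u ∈ χ b, (u : V) ∈ br w
      · obtain ⟨u, hu⟩ := h
        exact ⟨u, fun _ => hu⟩
      · obtain ⟨u, hu⟩ := (hconn w).nonempty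
        exact ⟨⟨u, hsub w hu⟩, fun h' => absurd h' h⟩
    choose f hf using hex
    refine (Finset.card_le_card_of_injOn f ?_ ?_).trans (hT.width_le b)
    · intro w hw
      simp only [Finset.coe_filter, Finset.mem_univ, true_and, Set.mem_ofPred_eq] at hw
      exact (hf w hw).1
    · intro w hw w' hw' h
      simp only [Finset.coe_filter, Finset.mem_univ, true_and, Set.mem_ofPred_eq] at hw hw'
      exact hdisj w w' _ (hf w hw).2 (h ▸ (hf w' hw').2)

theorem connected_induce_singleton (v : V) : (G.induce ({v} : Set V)).Connected :=
  connected_of_closed ⟨v, rfl⟩ fun U a ha haU _ => by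
    rintro b rfl; rwa [← Set.mem_singleton_iff.1 ha]

theorem TreewidthAtMost.of_injective [Finite W] {H : SimpleGraph W} {Y : Set V} {k : ℕ}
    (hG : TreewidthAtMost (G.induce Y) k) (f : W → V) (hf : Function.Injective f)
    (hY : ∀ w, f w ∈ Y) (hadj : ∀ w w', H.Adj w w' → G.Adj (f w) (f w')) :
    TreewidthAtMost H k :=
  hG.of_branchSets (fun w => {f w}) (by simpa using hY) (fun w => connected_induce_singleton _)
    (fun w w' u h h' => hf (by simp_all)) (fun w w' h => ⟨_, rfl, _, rfl, hadj w w' h⟩)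

theorem TreewidthAtMost.induce_mono [Finite V] {Y Z : Set V} {k : ℕ}
    (hG : TreewidthAtMost (G.induce Y) k) (h : Z ⊆ Y) : TreewidthAtMost (G.induce Z) k :=
  hG.of_injective Subtype.val Subtype.val_injective (fun w => h w.2) fun _ _ h => h

theorem TreewidthAtMost.of_card_le [Finite V] {k : ℕ} (h : Nat.card V ≤ k + 1) :
    TreewidthAtMost G k := by
  have := Fintype.ofFinite V
  refine ⟨Unit, inferInstance, ⊥, fun _ => Finset.univ, SimpleGraph.IsTree.of_subsingleton,
    fun v => ⟨(), by simp⟩, fun u v _ => ⟨(), by simp⟩, fun v => ?_, fun b => ?_⟩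
  · refine connected_of_closed ⟨(), by simp⟩ fun U a _ haU _ b _ => ?_
    rwa [Subsingleton.elim b a]
  · rwa [Finset.card_univ, ← Nat.card_eq_fintype_card]

end Minors

/-! ### Elimination orders -/

section Elimination

variable {V : Type*}

/-- An elimination order of width two: every vertex `v` comes with a set `A v` of at most two
earlier vertices, which contains all its earlier neighbours, and the earlier one of two vertices
of `A v` belongs to the set of the other. -/
structure Elimination (G : SimpleGraph V) where
  ord : V → ℕ
  inj : Function.Injective ord
  A : V → Finset V
  card_le : ∀ v, (A v).card ≤ 2
  lt : ∀ {u v}, u ∈ A v → ord u < ord v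
  clique : ∀ {u w v}, u ∈ A v → w ∈ A v → ord u < ord w → u ∈ A w
  adj : ∀ {u v}, G.Adj u v → ord u < ord v → u ∈ A v

/-- Shortest paths from `r` to `c` and to `c'` avoid `b`, which is farther away. Extended by `b`
they become two paths from `r` to `b`; in a tree these are equal, and so are their penultimate
vertices. -/
theorem isTree_parent_unique {ι : Type*} {T : SimpleGraph ι} (hT : T.IsTree) {r b c c' : ι}
    (h : T.Adj b c) (h' : T.Adj b c') (hd : T.dist r c < T.dist r b)
    (hd' : T.dist r c' < T.dist r b) : c = c' := by
  obtain ⟨p, hp, hpl⟩ := hT.connected.exists_path_of_dist r c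
  obtain ⟨p', hp', hpl'⟩ := hT.connected.exists_path_of_dist r c'
  have aux : ∀ (c : ι) (p : T.Walk r c), p.length = T.dist r c → T.dist r c < T.dist r b →
      b ∉ p.support := by
    intro c p hpl hd hb
    classical
    have h1 := p.length_takeUntil_le_length hb
    have h2 := SimpleGraph.dist_le (p.takeUntil b hb)
    omega
  have e : p.concat h.symm = p'.concat h'.symm :=
    (hT.existsUnique_path r b).unique (hp.concat (aux c p hpl hd) h.symm)
      (hp'.concat (aux c' p' hpl' hd') h'.symm)
  have := congrArg SimpleGraph.Walk.penultimate e
  simpa using this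

/-- A connected set of nodes of a rooted tree contains the parent of each of its nodes, except for
its top node. -/
theorem isTree_exists_parent_mem {ι : Type*} {T : SimpleGraph ι} (hT : T.IsTree) {r b s : ι}
    {S : Set ι} (hS : (T.induce S).Preconnected) (hb : b ∈ S) (hs : s ∈ S) (hne : s ≠ b)
    (hd : T.dist r s ≤ T.dist r b) : ∃ p ∈ S, T.Adj b p ∧ T.dist r p < T.dist r b := by
  by_contra hcon
  push Not at hcon
  let P : ι → ι → Prop := fun c c' => T.Adj c c' ∧ T.dist r c' < T.dist r c
  -- Without a parent of `b` in `S`, connectedness keeps all of `S` below `b`. But `s ≠ b` is no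
  -- deeper than `b`.
  have hsub : S ⊆ {c | Relation.ReflTransGen P c b} := by
    refine subset_of_closed hS hb Relation.ReflTransGen.refl ?_
    intro c hc hcb c' hc' h
    have hne := hT.dist_ne_of_adj r h
    rcases lt_or_gt_of_ne hne with hlt | hlt
    · exact Relation.ReflTransGen.head ⟨h.symm, hlt⟩ hcb
    · rcases Relation.ReflTransGen.cases_head hcb with rfl | ⟨c'', h1, h2⟩
      · exact absurd hlt (not_lt.2 (hcon c' hc' h))
      · rwa [isTree_parent_unique hT h h1.1 hlt h1.2]
  have hle : ∀ c, Relation.ReflTransGen P c b → T.dist r b ≤ T.dist r c := by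
    intro c hc
    induction hc using Relation.ReflTransGen.head_induction_on with
    | refl => exact le_rfl
    | head h _ ih => exact ih.trans h.2.le
  rcases Relation.ReflTransGen.cases_head (hsub hs) with h | ⟨c, h1, h2⟩
  · exact hne h
  · have := hle c h2
    have := h1.2
    omega

open Classical in
-- The tree is rooted at a bag containing `d`, and vertices are ordered by the depth of their
-- topmost bag, ties being broken arbitrarily. The set `A v` consists of the earlier vertices in the
-- topmost bag of `v`; that bag has at most three elements, one of which is `v`.
theorem exists_elimination [Finite V] {G : SimpleGraph V} (hG : TreewidthAtMost G 2) (d : V) :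
    ∃ E : Elimination G, ∀ v, E.ord d ≤ E.ord v := by
  obtain ⟨ι, hι, T, χ, hT⟩ := hG
  obtain ⟨r, hr⟩ := hT.vertex_covered d
  have htop : ∀ v, ∃ b, v ∈ χ b ∧ ∀ b', v ∈ χ b' → T.dist r b ≤ T.dist r b' := fun v =>
    (Set.toFinite {b | v ∈ χ b}).exists_minimalFor (fun b => T.dist r b) _ (hT.vertex_covered v) |>.imp
      fun b hb => ⟨hb.1, fun b' hb' => by
        rcases le_total (T.dist r b) (T.dist r b') with h | h
        · exact h
        · exact hb.2 hb' h⟩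
  choose top htop hmin using htop
  -- Climbing from a common bag of `u` and `w`: before the top of `w` is reached, the parent bag
  -- contains `w`, and also `u`, because the top of `u` is no deeper.
  have key : ∀ (u w : V), T.dist r (top u) ≤ T.dist r (top w) → ∀ (k : ℕ) (b : ι), T.dist r b = k →
      u ∈ χ b → w ∈ χ b → u ∈ χ (top w) := by
    intro u w huw k
    induction k using Nat.strong_induction_on with
    | _ k ih =>
      intro b hk hu hw
      by_cases hbw : top w = b
      · rwa [hbw]
      obtain ⟨p, hp, hbp, hpd⟩ := isTree_exists_parent_mem hT.isTree (hT.connected w).preconnected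
        hw (htop w) hbw (hmin w b hw)
      by_cases hbu : top u = b
      · have := hmin w p hp
        rw [hbu] at huw
        omega
      obtain ⟨p', hp', hbp', hpd'⟩ := isTree_exists_parent_mem hT.isTree
        (hT.connected u).preconnected hu (htop u) hbu (hmin u b hu)
      obtain rfl := isTree_parent_unique hT.isTree hbp hbp' hpd hpd'
      exact ih _ (hk ▸ hpd) p rfl hp' hp
  have hN : 0 < Nat.card V := Nat.card_pos_iff.2 ⟨⟨d⟩, inferInstance⟩
  -- The swap gives `d` the number 0, so `d` precedes all other vertices whose topmost bag is the
  -- root.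
  let e : V ≃ Fin (Nat.card V) := (Finite.equivFin V).trans (Equiv.swap (Finite.equivFin V d) ⟨0, hN⟩)
  have hed : e d = ⟨0, hN⟩ := by simp [e]
  let ord : V → ℕ := fun v => T.dist r (top v) * Nat.card V + e v
  have hord : ∀ u v, ord u ≤ ord v → T.dist r (top u) ≤ T.dist r (top v) := by
    intro u v h
    by_contra hlt
    have h1 : (T.dist r (top v) + 1) * Nat.card V ≤ T.dist r (top u) * Nat.card V :=
      Nat.mul_le_mul_right _ (by omega)
    have h2 := (e v).2
    rw [Nat.succ_mul] at h1
    simp only [ord] at h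
    omega
  refine ⟨⟨ord, ?_, fun v => (χ (top v)).filter fun u => ord u < ord v, ?_, ?_, ?_, ?_⟩, ?_⟩
  · intro u v h
    have h1 : T.dist r (top u) = T.dist r (top v) := le_antisymm (hord _ _ h.le) (hord _ _ h.ge)
    simp only [ord, h1] at h
    exact e.injective (Fin.ext (by omega))
  · intro v
    have h1 : ((χ (top v)).filter fun u => ord u < ord v) ⊆ (χ (top v)).erase v := by
      intro u hu
      rw [Finset.mem_filter] at hu
      exact Finset.mem_erase.2 ⟨by rintro rfl; omega, hu.1⟩
    have h2 := Finset.card_le_card h1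
    rw [Finset.card_erase_of_mem (htop v)] at h2
    have := hT.width_le (top v)
    omega
  · intro u v hu
    exact (Finset.mem_filter.1 hu).2
  · intro u w v hu hw h
    rw [Finset.mem_filter] at hu hw ⊢
    exact ⟨key u w (hord _ _ h.le) _ _ rfl hu.1 hw.1, h⟩
  · intro u v h hlt
    obtain ⟨b, hb, hb'⟩ := hT.edge_covered u v h
    exact Finset.mem_filter.2 ⟨key u v (hord _ _ hlt.le) _ b rfl hb hb', hlt⟩
  · intro v
    have : T.dist r (top d) = 0 := by
      have := hmin d r hr
      simpa using this
    simp [ord, this, hed]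

namespace Elimination

variable {G : SimpleGraph V} (E : Elimination G)

/-- `p` is the parent of `w`: the latest vertex of `A w`. -/
def Par (w p : V) : Prop := p ∈ E.A w ∧ ∀ u ∈ E.A w, E.ord u ≤ E.ord p

/-- The descendants of `v`, including `v`. -/
def Desc (v : V) : Set V := {w | Relation.ReflTransGen E.Par w v}

variable {E}

theorem mem_desc_self (v : V) : v ∈ E.Desc v := Relation.ReflTransGen.refl

theorem exists_par {v u : V} (h : u ∈ E.A v) : ∃ p, E.Par v p := by
  obtain ⟨p, hp, hmax⟩ := (E.A v).exists_max_image E.ord ⟨u, h⟩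
  exact ⟨p, hp, hmax⟩

theorem Par.eq {w p p' : V} (h : E.Par w p) (h' : E.Par w p') : p = p' :=
  E.inj (le_antisymm (h'.2 _ h.1) (h.2 _ h'.1))

theorem Par.lt {w p : V} (h : E.Par w p) : E.ord p < E.ord w := E.lt h.1

/-- The members of `A w` other than the parent of `w` belong to `A` of the parent. -/
theorem Par.mem {w p u : V} (h : E.Par w p) (hu : u ∈ E.A w) (hne : u ≠ p) : u ∈ E.A p :=
  E.clique hu h.1 (lt_of_le_of_ne (h.2 u hu) (fun e => hne (E.inj e)))

theorem ord_le_of_mem_desc {u v : V} (h : u ∈ E.Desc v) : E.ord v ≤ E.ord u := by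
  induction h using Relation.ReflTransGen.head_induction_on with
  | refl => exact le_rfl
  | head h _ ih => exact ih.trans h.lt.le

/-- Climbing from `u` by parents, `v` stays in the set `A` of the current vertex until it is itself
the parent. -/
theorem mem_desc_of_mem {u v : V} (h : v ∈ E.A u) : u ∈ E.Desc v := by
  induction hk : E.ord u using Nat.strong_induction_on generalizing u with
  | _ k ih =>
    obtain ⟨p, hp⟩ := exists_par h
    by_cases hvp : v = p
    · subst hvp; exact Relation.ReflTransGen.single hp
    · exact Relation.ReflTransGen.head hp (ih _ (hk ▸ hp.lt) (hp.mem h hvp) rfl)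

theorem mem_of_mem_desc {u v w : V} (h : u ∈ E.Desc v) (hw : w ∈ E.A u) (hlt : E.ord w < E.ord v) :
    w ∈ E.A v := by
  induction h using Relation.ReflTransGen.head_induction_on with
  | refl => exact hw
  | head h h' ih =>
    refine ih (h.mem hw ?_)
    rintro rfl
    exact absurd (ord_le_of_mem_desc h') (not_le.2 hlt)

theorem mem_desc_or_mem {u v w : V} (h : u ∈ E.Desc v) (hw : w ∈ E.A u) :
    w ∈ E.Desc v ∨ w ∈ E.A v := by
  induction h using Relation.ReflTransGen.head_induction_on with
  | refl => exact Or.inr hw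
  | @head a p h h' ih =>
    by_cases hwp : w = p
    · subst hwp; exact Or.inl h'
    · exact ih (h.mem hw hwp)

/-- The neighbours of the descendants of `v` are descendants of `v` or belong to `A v`. -/
theorem adj_desc {u v w : V} (h : u ∈ E.Desc v) (hadj : G.Adj u w) : w ∈ E.Desc v ∨ w ∈ E.A v := by
  rcases lt_trichotomy (E.ord u) (E.ord w) with hlt | he | hlt
  · exact Or.inl (Relation.ReflTransGen.trans (mem_desc_of_mem (E.adj hadj hlt)) h)
  · exact absurd (E.inj he) hadj.ne
  · exact mem_desc_or_mem h (E.adj hadj.symm hlt)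

end Elimination

/-- Since the first vertex `none` is in `A (some c)`, at most one further vertex `u` is. By
`adj_desc`, the descendants of `c` in `W` have no other neighbour than `u` outside themselves,
although the two earlier vertices `a` and `b` are not descendants. So `u` would be a cut vertex.
`attach_le_two` applies this to the latest of the three neighbours. -/
theorem attach_aux {W : Type*} {G : SimpleGraph (Option W)} {E : Elimination G}
    (hd : ∀ v, E.ord none ≤ E.ord v) (hcut : NoCutVertex (G.comap some)) {a b c : W}
    (hab : a ≠ b) (hac : E.ord (some a) < E.ord (some c)) (hbc : E.ord (some b) < E.ord (some c))
    (hc : G.Adj none (some c)) : False := by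
  have hnone : none ∈ E.A (some c) := E.adj hc (lt_of_le_of_ne (hd _) fun h => by simpa using E.inj h)
  have hmem : ∀ x y, some x ∈ E.A (some c) → some y ∈ E.A (some c) → x = y := by
    intro x y hx hy
    classical
    by_contra hne
    have h1 : ({none, some x, some y} : Finset (Option W)) ⊆ E.A (some c) := by
      intro z hz; simp only [Finset.mem_insert, Finset.mem_singleton] at hz
      rcases hz with rfl | rfl | rfl <;> assumption
    have h2 := Finset.card_le_card h1
    rw [Finset.card_eq_three.2 ⟨none, some x, some y, by simp, by simp, by simpa using hne, rfl⟩] at h2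
    have := E.card_le (some c)
    omega
  have hnot : ∀ x, E.ord (some x) < E.ord (some c) → some x ∉ E.Desc (some c) := fun x hx h =>
    absurd (Elimination.ord_le_of_mem_desc h) (not_le.2 hx)
  have main : ∀ u, (∀ y, some y ∈ E.A (some c) → y = u) → u ≠ c → False := by
    intro u hu huc
    have h := hcut {w | some w ∈ E.Desc (some c)} u ⟨c, Elimination.mem_desc_self _, huc.symm⟩
      (fun x hx y hxy => (Elimination.adj_desc hx hxy).imp id (hu y))
    have h1 := (h a).resolve_left (hnot a hac)
    have h2 := (h b).resolve_left (hnot b hbc)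
    exact hab (h1.trans h2.symm)
  by_cases hex : ∃ u, some u ∈ E.A (some c)
  · obtain ⟨u, hu⟩ := hex
    exact main u (fun y hy => hmem y u hy hu) (by rintro rfl; exact absurd (E.lt hu) (lt_irrefl _))
  · push Not at hex
    exact main a (fun y hy => absurd hy (hex y)) (by rintro rfl; omega)

/-- In a graph of treewidth at most two, a vertex outside a subgraph without cut vertices has at
most two neighbours in it. -/
theorem attach_le_two {W : Type*} [Finite W] {G : SimpleGraph (Option W)} (hG : TreewidthAtMost G 2)
    (hcut : NoCutVertex (G.comap some)) {a b c : W} (hab : a ≠ b) (hac : a ≠ c) (hbc : b ≠ c)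
    (ha : G.Adj none (some a)) (hb : G.Adj none (some b)) (hc : G.Adj none (some c)) : False := by
  obtain ⟨E, hd⟩ := exists_elimination hG none
  have ne {x y : W} (h : x ≠ y) : E.ord (some x) ≠ E.ord (some y) := fun e => h (by simpa using E.inj e)
  have h1 := ne hab
  have h2 := ne hac
  have h3 := ne hbc
  by_cases h : E.ord (some a) < E.ord (some c) ∧ E.ord (some b) < E.ord (some c)
  · exact attach_aux hd hcut hab h.1 h.2 hc
  · by_cases h' : E.ord (some a) < E.ord (some b) ∧ E.ord (some c) < E.ord (some b)
    · exact attach_aux hd hcut hac h'.1 h'.2 hb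
    · exact attach_aux hd hcut hbc (by omega) (by omega) ha

end Elimination

/-! ### The boundary of a biconnected subgraph -/

section Boundary

variable {V : Type*} {G : SimpleGraph V}

theorem contractComponentApplicable_of_connected {D : Set V} (hD : (G.induce D).Connected)
    (h : TreewidthAtMost ((G ⊔ cliqueOn (openNbhd G D)).induce (closedNbhd G D)) 2) :
    ContractComponentApplicable G :=
  ⟨(⊤ : G.Subgraph).induce D, SimpleGraph.connected_induce_iff.1 hD, h⟩

variable [Finite V]

/-- The vertices of `B` with a neighbour in `D`. -/
def attachments (G : SimpleGraph V) (B D : Set V) : Set V := {b | b ∈ B ∧ ∃ u ∈ D, G.Adj u b}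

/-- Contracting `D` to the single vertex `none` gives a minor of `G[Y]` on `Option B`, to which
`attach_le_two` applies. -/
theorem ncard_attachments_le {Y B D : Set V} (hY : TreewidthAtMost (G.induce Y) 2)
    (hD : (G.induce D).Connected) (hDY : D ⊆ Y) (hBY : B ⊆ Y) (hdisj : Disjoint D B)
    (hB : NoCutVertex (G.induce B)) : (attachments G B D).ncard ≤ 2 := by
  by_contra hcon
  obtain ⟨a, ha, b, hb, c, hc, hab, hac, hbc⟩ := (Set.two_lt_ncard (Set.toFinite _)).1 (not_le.1 hcon)
  let br : Option B → Set V := fun o => o.elim D fun b => {(b : V)}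
  let H : SimpleGraph (Option B) :=
    { Adj := fun o o' => o ≠ o' ∧ ∃ u ∈ br o, ∃ u' ∈ br o', G.Adj u u'
      symm := ⟨fun o o' ⟨h, u, hu, u', hu', h'⟩ => ⟨h.symm, u', hu', u, hu, h'.symm⟩⟩
      loopless := ⟨fun o h => h.1 rfl⟩ }
  have hH : TreewidthAtMost H 2 := by
    refine hY.of_branchSets br ?_ ?_ ?_ fun w w' h => h.2
    · rintro (_ | b)
      · exact hDY
      · simpa [br] using hBY b.2
    · rintro (_ | b)
      · exact hD
      · exact connected_induce_singleton _
    · rintro (_ | b) (_ | b') u hu hu'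
      · rfl
      · obtain rfl : u = b' := hu'
        exact absurd b'.2 (Set.disjoint_left.1 hdisj hu)
      · obtain rfl : u = b := hu
        exact absurd b.2 (Set.disjoint_left.1 hdisj hu')
      · exact congrArg some (Subtype.ext (Eq.trans (Eq.symm hu) hu'))
  have hcm : H.comap some = G.induce B := by
    ext x y
    simp only [SimpleGraph.comap_adj, H, br]
    constructor
    · rintro ⟨_, u, rfl, u', rfl, h⟩; exact h
    · intro h
      exact ⟨by rintro ⟨⟩; exact h.ne rfl, x, rfl, y, rfl, h⟩
  have hn : ∀ (b : V) (hb : b ∈ attachments G B D), H.Adj none (some ⟨b, hb.1⟩) := by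
    rintro b ⟨hb, u, hu, h⟩
    exact ⟨by simp, u, hu, b, rfl, h⟩
  exact attach_le_two hH (hcm ▸ hB) (by simpa using hab) (by simpa using hac) (by simpa using hbc)
    (hn a ha) (hn b hb) (hn c hc)

/-- A connected set with at most two neighbours, all of them in `B`, can be contracted. -/
theorem contractComponentApplicable_of_attachments {Y B D : Set V}
    (hY : TreewidthAtMost (G.induce Y) 2) (hD : (G.induce D).Connected) (hDY : D ⊆ Y) (hBY : B ⊆ Y)
    (hdisj : Disjoint D B) (hBc : (G.induce B).Connected) (hB : NoCutVertex (G.induce B))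
    (hN : openNbhd G D ⊆ B) : ContractComponentApplicable G := by
  have h2 : (openNbhd G D).ncard ≤ 2 := by
    refine (Set.ncard_le_ncard (fun b hb => ?_) (Set.toFinite _)).trans
      (ncard_attachments_le hY hD hDY hBY hdisj hB)
    exact ⟨hN hb, hb.2⟩
  refine contractComponentApplicable_of_connected hD ?_
  have hsub : closedNbhd G D ⊆ Y := Set.union_subset (hN.trans hBY) hDY
  by_cases hex : ∃ u v, u ∈ openNbhd G D ∧ v ∈ openNbhd G D ∧ u ≠ v
  · obtain ⟨u, v, hu, hv, huv⟩ := hex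
    have huvN : openNbhd G D = {u, v} := by
      refine (Set.eq_of_subset_of_ncard_le ?_ ?_ (Set.toFinite _)).symm
      · rintro w (rfl | rfl) <;> assumption
      · rwa [Set.ncard_pair huv]
    -- The clique edge `uv` is obtained as a minor by contracting `B \ {v}` onto `u`: this set is
    -- connected as `v` is no cut vertex, and it has a neighbour of `v` as `B` is connected.
    have hconn : (G.induce (B \ {v})).Connected := by
      refine connected_of_closed ⟨u, hN hu, huv⟩ fun U a ha haU hU => ?_
      have hpc := hB.induce_compl_preconnected ⟨v, hN hv⟩
      have := subset_of_closed (U := {b : B | (b : V) ∈ U}) hpc (a := ⟨a, ha.1⟩)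
        (fun h => ha.2 (congrArg Subtype.val h)) haU (fun x hx hxU y hy hxy =>
          hU x ⟨x.2, fun h => hx (Subtype.ext h)⟩ hxU y ⟨y.2, fun h => hy (Subtype.ext h)⟩ hxy)
      exact fun b hb => this (show (⟨b, hb.1⟩ : B) ∈ _ from fun h => hb.2 (congrArg Subtype.val h))
    obtain ⟨w, hwB, hwv⟩ : ∃ w ∈ B \ {v}, G.Adj w v := by
      by_contra hno
      push Not at hno
      have := subset_of_closed (U := B \ {v}) hBc.preconnected (hN hu) ⟨hN hu, huv⟩
        (fun x _ hx y hy hxy => ⟨hy, by rintro rfl; exact hno x hx hxy⟩) (hN hv)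
      exact this.2 rfl
    classical
    let br : closedNbhd G D → Set V := fun w => if (w : V) = u then B \ {v} else {(w : V)}
    have hbr : ∀ w : closedNbhd G D, (w : V) ∈ br w := by
      intro w
      by_cases h : (w : V) = u
      · simp only [br, if_pos h]; rw [h]; exact ⟨hN hu, huv⟩
      · simp [br, h]
    have hin : ∀ (w : closedNbhd G D) x, x ∈ br w → x ∈ B → x ≠ v → (w : V) = u := by
      intro w x hx hxB hxv
      by_contra h
      simp only [br, if_neg h] at hx
      obtain rfl : x = w := hx
      rcases w.2 with h' | h'
      · rw [huvN] at h'
        rcases h' with h' | h'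
        · exact h h'
        · exact hxv h'
      · exact Set.disjoint_left.1 hdisj h' hxB
    refine hY.of_branchSets br ?_ ?_ ?_ ?_
    · intro w
      by_cases h : (w : V) = u
      · simp only [br, if_pos h]; exact Set.sdiff_subset.trans hBY
      · simp only [br, if_neg h]; simpa using hsub w.2
    · intro w
      by_cases h : (w : V) = u
      · rw [show br w = B \ {v} from if_pos h]; exact hconn
      · rw [show br w = {(w : V)} from if_neg h]; exact connected_induce_singleton _
    · intro w w' x hx hx'
      apply Subtype.ext
      by_cases h : (w : V) = u
      · have hx2 := hx
        simp only [br, if_pos h] at hx2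
        rw [h, hin w' x hx' hx2.1 hx2.2]
      · by_cases h' : (w' : V) = u
        · have hx2 := hx'
          simp only [br, if_pos h'] at hx2
          rw [h', hin w x hx hx2.1 hx2.2]
        · simp only [br, if_neg h, if_neg h'] at hx hx'
          exact Eq.trans (Eq.symm hx) hx'
    · intro x y hxy
      rcases hxy with hxy | ⟨hx, hy, hne⟩
      · exact ⟨x, hbr x, y, hbr y, hxy⟩
      · have hbu : ∀ z : closedNbhd G D, (z : V) = u → w ∈ br z := by
          intro z hz; simp only [br, if_pos hz]; exact hwB
        replace hx : (x : V) ∈ openNbhd G D := hx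
        replace hy : (y : V) ∈ openNbhd G D := hy
        rw [huvN] at hx hy
        rcases hx with hx | hx <;> rcases hy with hy | hy
        · exact absurd (hx.trans hy.symm) hne
        · exact ⟨w, hbu x hx, y, hbr y, by rw [hy]; exact hwv⟩
        · exact ⟨x, hbr x, w, hbu y hy, by rw [hx]; exact hwv.symm⟩
        · exact absurd (hx.trans hy.symm) hne
  · push Not at hex
    refine hY.of_injective Subtype.val Subtype.val_injective (fun w => hsub w.2) ?_
    rintro x y (h | ⟨hx, hy, hne⟩)
    · exact h
    · exact absurd (hex _ _ hx hy) hne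

/-- Here `D x` is what `x` reaches outside `X ∪ B`. It lies in `G - (X \ {x})`, which has treewidth
at most two by tidiness, so it is attached to at most two vertices of `B`. The sets `D x` cover the
complement of `B`, hence account for the whole boundary. -/
theorem ncard_boundary_le {X : Finset V} {B : Set V} (hX : IsTidyModulator G (X : Set V))
    (hC : ¬ ContractComponentApplicable G) (hd : Disjoint B (X : Set V))
    (hB : IsBiconnected (G.induce B)) : (boundary G B).ncard ≤ 2 * X.card := by
  classical
  have hcut := hB.noCutVertex
  let R : Set V := ((X : Set V) ∪ B)ᶜ
  have hRB : Disjoint R B := Set.disjoint_left.2 fun x hx hxB => hx (Or.inr hxB)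
  let D : V → Set V := fun x => componentIn G (insert x R) x
  have hDsub : ∀ x, D x ⊆ insert x R := fun x => componentIn_subset (Set.mem_insert _ _)
  have h2 : ∀ x ∈ X, (attachments G B (D x)).ncard ≤ 2 := by
    intro x hx
    refine ncard_attachments_le (hX.2 x hx) (componentIn_connected (Set.mem_insert _ _)) ?_ ?_ ?_ hcut
    · intro y hy
      rcases hDsub x hy with rfl | h
      · exact fun h => h.2 rfl
      · exact fun h' => h (Or.inl h'.1)
    · exact fun y hy h => Set.disjoint_left.1 hd hy h.1
    · refine Set.disjoint_left.2 fun y hy hyB => ?_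
      rcases hDsub x hy with rfl | h
      · exact Set.disjoint_left.1 hd hyB hx
      · exact h (Or.inr hyB)
  -- A component of `G - (X ∪ B)` without neighbours in `X` has all its neighbours in `B`, so it
  -- could be contracted.
  have hcover : ∀ y ∉ B, ∃ x ∈ X, y ∈ D x := by
    intro y hyB
    by_cases hyX : y ∈ X
    · exact ⟨y, hyX, mem_componentIn_self y⟩
    have hyR : y ∈ R := by rintro (h | h); exacts [hyX h, hyB h]
    let C := componentIn G R y
    have hCc : (G.induce C).Connected := componentIn_connected hyR
    have hCR : C ⊆ R := componentIn_subset hyR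
    obtain ⟨x, hx, u, hu, hux⟩ : ∃ x ∈ X, ∃ u ∈ C, G.Adj u x := by
      by_contra hno
      push Not at hno
      refine hC (contractComponentApplicable_of_attachments (Y := (X : Set V)ᶜ) (B := B) (D := C) hX.1
        hCc (fun z hz h => hCR hz (Or.inl h)) (fun z hz h => Set.disjoint_left.1 hd hz h)
        (hRB.mono_left hCR) hB.1 hcut ?_)
      rintro w ⟨hw, u, hu, huw⟩
      by_contra hwB
      refine hw (componentIn_closed hu ?_ huw)
      rintro (h | h)
      · exact hno w h u hu huw
      · exact hwB h
    have huD : u ∈ D x := componentIn_closed (mem_componentIn_self x) (Or.inr (hCR hu)) hux.symm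
    refine ⟨x, hx, subset_of_closed hCc.preconnected hu huD ?_ (mem_componentIn_self y)⟩
    intro a _ haD b hb hab
    exact componentIn_closed haD (Or.inr (hCR hb)) hab
  have := Fintype.ofFinite V
  have hsub : boundary G B ⊆ ((X.biUnion fun x => (attachments G B (D x)).toFinset : Finset V) : Set V) := by
    rintro b ⟨hb, y, hy, hyb⟩
    obtain ⟨x, hx, hyx⟩ := hcover y hy
    simp only [Finset.coe_biUnion, Set.coe_toFinset, Set.mem_iUnion]
    exact ⟨x, hx, by simpa using hb, y, hyx, hyb⟩
  refine (Set.ncard_le_ncard hsub (Set.toFinite _)).trans ?_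
  rw [Set.ncard_coe_finset, Nat.mul_comm]
  refine Finset.card_biUnion_le_card_mul _ _ _ fun x hx => ?_
  rw [← Set.ncard_eq_toFinset_card']
  exact h2 x hx

/-- If the contract component reduction cannot be applied, then all degrees are at least three. -/
theorem two_lt_ncard_neighborSet (hC : ¬ ContractComponentApplicable G) (v : V) :
    2 < (G.neighborSet v).ncard := by
  by_contra hcon
  -- A closed neighbourhood with at most three vertices fits into one bag.
  refine hC (contractComponentApplicable_of_connected (connected_induce_singleton v)
    (TreewidthAtMost.of_card_le ?_))
  have hsub : closedNbhd G {v} ⊆ insert v (G.neighborSet v) := by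
    rintro w (⟨_, u, rfl, h⟩ | rfl)
    · exact Or.inr h
    · exact Or.inl rfl
  have h1 := Set.ncard_le_ncard hsub (Set.toFinite _)
  have h2 := Set.ncard_insert_le v (G.neighborSet v)
  rw [Nat.card_coe_set_eq]
  omega

end Boundary

/-! ### Long chains in an elimination order -/

section Chain

variable {W : Type*} {H : SimpleGraph W} {E : Elimination H}

namespace Elimination

/-- A non-trivial descendant of `v` is a descendant of a child of `v`. -/
theorem exists_child_of_mem_desc {u v : W} (h : u ∈ E.Desc v) (hne : u ≠ v) :
    ∃ x, E.Par x v ∧ u ∈ E.Desc x := by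
  rcases Relation.ReflTransGen.cases_tail h with h | ⟨x, h1, h2⟩
  · exact absurd h.symm hne
  · exact ⟨x, h2, h1⟩

/-- Later neighbours of `v` are proper descendants, so a vertex without children has all its
neighbours in `A v`, which has at most two elements. -/
theorem exists_child [Finite W] {v : W} (hdeg : 2 < (H.neighborSet v).ncard) : ∃ x, E.Par x v := by
  by_contra hno
  push Not at hno
  have hsub : H.neighborSet v ⊆ (E.A v : Set W) := by
    intro u hu
    rcases lt_trichotomy (E.ord u) (E.ord v) with hlt | he | hlt
    · exact E.adj (SimpleGraph.Adj.symm hu) hlt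
    · exact absurd (E.inj he) (SimpleGraph.Adj.ne hu).symm
    · obtain ⟨x, hx, -⟩ := exists_child_of_mem_desc (mem_desc_of_mem (E.adj hu hlt))
        (SimpleGraph.Adj.ne hu).symm
      exact absurd hx (hno x)
  have h1 := Set.ncard_le_ncard hsub (Set.toFinite _)
  rw [Set.ncard_coe_finset] at h1
  have := E.card_le v
  omega

open Classical in
/-- There are at most as many branching vertices as there are leaves. -/
theorem card_branching_le [Fintype W] (E : Elimination H) :
    (Finset.univ.filter fun v => ∃ x y, x ≠ y ∧ E.Par x v ∧ E.Par y v).card ≤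
      (Finset.univ.filter fun v => ¬ ∃ x, E.Par x v).card := by
  let ch : W → Finset W := fun v => Finset.univ.filter fun x => E.Par x v
  have h1 : ∑ v, (ch v).card ≤ Fintype.card W := by
    rw [← Finset.card_biUnion, ← Finset.card_univ]
    · exact Finset.card_le_card (Finset.subset_univ _)
    · intro v _ v' _ hne
      refine Finset.disjoint_left.2 fun x hx hx' => hne ?_
      simp only [ch, Finset.mem_filter, Finset.mem_univ, true_and] at hx hx'
      exact hx.eq hx'
  -- In a forest the numbers of children, each minus one, have a sum of at most zero; leaves
  -- contribute `-1` and branching vertices at least `1`.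
  have h2 : ∀ v, 1 + (if ∃ x y, x ≠ y ∧ E.Par x v ∧ E.Par y v then 1 else 0) ≤
      (ch v).card + (if ¬ ∃ x, E.Par x v then 1 else 0) := by
    intro v
    by_cases hb : ∃ x y, x ≠ y ∧ E.Par x v ∧ E.Par y v
    · obtain ⟨x, y, hne, hx, hy⟩ := hb
      have : 1 < (ch v).card := Finset.one_lt_card.2 ⟨x, by simpa [ch] using hx, y, by simpa [ch] using hy, hne⟩
      rw [if_pos ⟨x, y, hne, hx, hy⟩]
      omega
    · rw [if_neg hb]
      by_cases hl : ∃ x, E.Par x v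
      · obtain ⟨x, hx⟩ := hl
        have : 0 < (ch v).card := Finset.card_pos.2 ⟨x, by simpa [ch] using hx⟩
        omega
      · rw [if_pos hl]; omega
  have h3 := Finset.sum_le_sum fun v (_ : v ∈ Finset.univ) => h2 v
  rw [Finset.sum_add_distrib, Finset.sum_add_distrib, ← Finset.card_filter, ← Finset.card_filter] at h3
  simp only [Finset.sum_const, smul_eq_mul, mul_one, Finset.card_univ] at h3
  omega

open Classical in
/-- If all vertices outside `M` have degree at least three, and there are more than
`2 * |M| * L` vertices, then there is a chain of `L` vertices outside `M`, each of which is the only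
child of the previous one. -/
theorem exists_chain [Fintype W] (E : Elimination H) (M : Finset W)
    (hM : ∀ v ∉ M, 2 < (H.neighborSet v).ncard) (L : ℕ) (hL : 2 * M.card * L < Fintype.card W) :
    ∃ w : ℕ → W, ∀ i, i < L → w i ∉ M ∧ E.Par (w (i + 1)) (w i) ∧
      ∀ u, E.Par u (w i) → u = w (i + 1) := by
  let Good : W → Prop := fun v => v ∉ M ∧ ∃ x, E.Par x v ∧ ∀ u, E.Par u v → u = x
  have hch : ∀ v, ∃ x, Good v → E.Par x v ∧ ∀ u, E.Par u v → u = x := by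
    intro v
    by_cases h : Good v
    · obtain ⟨x, hx⟩ := h.2; exact ⟨x, fun _ => hx⟩
    · exact ⟨v, fun h' => absurd h' h⟩
  choose ch hch using hch
  have hpar : ∀ v, ∃ p, ∀ q, E.Par v q → p = q := by
    intro v
    by_cases h : ∃ q, E.Par v q
    · obtain ⟨q, hq⟩ := h; exact ⟨q, fun q' hq' => hq.eq hq'⟩
    · exact ⟨v, fun q hq => absurd ⟨q, hq⟩ h⟩
  choose par hpar using hpar
  by_contra hno
  let bad : Finset W := Finset.univ.filter fun v => ¬ Good v
  -- A bad vertex lies in `M` or is branching. All leaves lie in `M`, so there are at most `|M|`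
  -- branching vertices.
  have hbad : bad.card ≤ 2 * M.card := by
    have hsub : bad ⊆ M ∪ Finset.univ.filter fun v => ∃ x y, x ≠ y ∧ E.Par x v ∧ E.Par y v := by
      intro v hv
      rw [Finset.mem_union]
      by_cases hvM : v ∈ M
      · exact Or.inl hvM
      · refine Or.inr (Finset.mem_filter.2 ⟨Finset.mem_univ _, ?_⟩)
        obtain ⟨x, hx⟩ := exists_child (E := E) (hM v hvM)
        by_contra hno
        refine (Finset.mem_filter.1 hv).2 ⟨hvM, x, hx, fun u hu => ?_⟩
        by_contra hne
        exact hno ⟨u, x, hne, hu, hx⟩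
    have hleaf : (Finset.univ.filter fun v => ¬ ∃ x, E.Par x v) ⊆ M := by
      intro v hv
      by_contra hvM
      exact (Finset.mem_filter.1 hv).2 (exists_child (hM v hvM))
    have h1 := Finset.card_le_card hsub
    have h2 := Finset.card_union_le M (Finset.univ.filter fun v => ∃ x y, x ≠ y ∧ E.Par x v ∧ E.Par y v)
    have h3 := E.card_branching_le
    have h4 := Finset.card_le_card hleaf
    omega
  -- Without a chain, following only children from `v` meets a bad vertex in fewer than `L` steps.
  -- That vertex and the number of steps determine `v`, by going back along parents.
  have hcover : (Finset.univ : Finset W) ⊆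
      (bad ×ˢ Finset.range L).image fun x => par^[x.2] x.1 := by
    intro v _
    obtain ⟨j, hj, hjb⟩ : ∃ j, j < L ∧ ¬ Good (ch^[j] v) := by
      by_contra hall
      push Not at hall
      refine hno ⟨fun i => ch^[i] v, fun i hi => ⟨(hall i hi).1, ?_⟩⟩
      simp only [Function.iterate_succ_apply']
      exact hch _ (hall i hi)
    classical
    let j₀ := Nat.find (⟨j, hjb⟩ : ∃ j, ¬ Good (ch^[j] v))
    have hj₀ : ¬ Good (ch^[j₀] v) := Nat.find_spec (⟨j, hjb⟩ : ∃ j, ¬ Good (ch^[j] v))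
    have hmin : ∀ i < j₀, Good (ch^[i] v) := fun i hi => not_not.1 (Nat.find_min _ hi)
    have hle : j₀ ≤ j := Nat.find_le hjb
    have hback : ∀ i ≤ j₀, par^[i] (ch^[i] v) = v := by
      intro i
      induction i with
      | zero => intro _; rfl
      | succ i ih =>
        intro hi
        rw [Function.iterate_succ_apply, Function.iterate_succ_apply',
          hpar _ _ (hch _ (hmin i (by omega))).1]
        exact ih (by omega)
    exact Finset.mem_image.2 ⟨(ch^[j₀] v, j₀), Finset.mem_product.2
      ⟨Finset.mem_filter.2 ⟨Finset.mem_univ _, hj₀⟩, Finset.mem_range.2 (by simpa using by omega)⟩,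
      hback j₀ le_rfl⟩
  have h1 := (Finset.card_le_card hcover).trans Finset.card_image_le
  rw [Finset.card_product, Finset.card_range, Finset.card_univ] at h1
  have := Nat.mul_le_mul_right L hbad
  omega

end Elimination

/-- A long narrow part of a graph of treewidth two. The bags are `{w (i - 1), z i, w i}`, and two
consecutive bags have two vertices in common. -/
structure IsStrip (H : SimpleGraph W) (K : ℕ) (w z : ℕ → W) : Prop where
  inj : ∀ i j, i ≤ K → j ≤ K → w i = w j → i = j
  step : ∀ i, i + 1 < K → z (i + 2) = z (i + 1) ∨ z (i + 2) = w i
  z_ne : ∀ i, i < K → z (i + 1) ≠ w i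
  thread : ∀ i, i + 1 < K → z (i + 2) = z (i + 1) → H.Adj (w i) (w (i + 1))
  thread' : ∀ i, i + 1 < K → z (i + 2) ≠ z (i + 1) → H.Adj (z (i + 1)) (w (i + 1))
  back : ∀ i j, i ≤ j → j < K → H.Adj (w i) (w (j + 1)) → i = j ∨ w i = z (j + 1)
  nbr : ∀ i j, i + 1 < j → j < K → w (i + 1) ≠ z (j + 1) → ∀ u, H.Adj (w (i + 1)) u →
    u = w i ∨ u = z (i + 1) ∨ ∃ l, i + 1 < l ∧ l ≤ j ∧ u = w l
  deg : ∀ i, i ≤ K → 2 < (H.neighborSet (w i)).ncard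

/-- The set `A (w (i + 1))` has exactly two elements, the parent `w i` and another one, `z (i + 1)`.
The clique property leaves two choices for `z (i + 2)`, the elements of `A (w (i + 1))`. The element
that drops out must be adjacent to `w (i + 1)`, for otherwise the one that stays would be a cut
vertex. The vertex `w₀ 0` is left out of the strip so that a vertex remains above it. -/
theorem exists_isStrip [Finite W] (hcut : NoCutVertex H) (M : Finset W)
    (hM : ∀ v ∉ M, 2 < (H.neighborSet v).ncard) (K : ℕ) (E : Elimination H) (w₀ : ℕ → W)
    (hw₀ : ∀ i, i < K + 2 → w₀ i ∉ M ∧ E.Par (w₀ (i + 1)) (w₀ i) ∧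
      ∀ u, E.Par u (w₀ i) → u = w₀ (i + 1)) :
    ∃ z, IsStrip H K (fun i => w₀ (i + 1)) z := by
  classical
  set w : ℕ → W := fun i => w₀ (i + 1) with hw
  have hord : ∀ i j, i < j → j < K + 3 → E.ord (w₀ i) < E.ord (w₀ j) := by
    intro i j hij
    induction j, hij using Nat.le_induction with
    | base => intro h; exact (hw₀ i (by omega)).2.1.lt
    | succ j hj ih => intro h; exact (ih (by omega)).trans (hw₀ j (by omega)).2.1.lt
  -- If `w i` were the only element, it would separate the descendants of `w (i + 1)` from `w₀ i`.
  have hcard : ∀ i, i < K → (E.A (w (i + 1))).card = 2 := by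
    intro i hi
    by_contra hne
    have hle := E.card_le (w (i + 1))
    obtain ⟨a, ha⟩ : ∃ a, E.A (w (i + 1)) = {a} :=
      Finset.card_eq_one.1 (by
        have : 0 < (E.A (w (i + 1))).card := Finset.card_pos.2 ⟨_, (hw₀ (i + 1) (by omega)).2.1.1⟩
        omega)
    have haw : w i = a := by
      have := (hw₀ (i + 1) (by omega)).2.1.1
      rw [show w₀ (i + 1 + 1) = w (i + 1) from rfl, ha, Finset.mem_singleton] at this
      exact this
    have h := hcut (E.Desc (w (i + 1))) a ⟨w (i + 1), Elimination.mem_desc_self _, fun h => by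
        rw [← haw] at h
        have := hord (i + 1) (i + 2) (by omega) (by omega)
        exact absurd (congrArg E.ord h) this.ne'⟩
      (fun u hu v huv => (Elimination.adj_desc hu huv).imp id (by rw [ha]; simp)) (w₀ i)
    rcases h with h | h
    · have h1 := Elimination.ord_le_of_mem_desc h
      have h2 := hord i (i + 2) (by omega) (by omega)
      exact absurd h1 (not_le.2 h2)
    · have h2 := hord i (i + 1) (by omega) (by omega)
      rw [← haw] at h
      exact absurd (congrArg E.ord h) h2.ne
  have hpar : ∀ i, i < K + 1 → E.Par (w (i + 1)) (w i) := fun i hi => (hw₀ (i + 1) (by omega)).2.1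
  have hz : ∀ i, ∃ z, i < K + 1 → 0 < i → z ≠ w (i - 1) ∧ E.A (w i) = {w (i - 1), z} := by
    intro i
    by_cases h : i < K + 1 ∧ 0 < i
    · obtain ⟨i, rfl⟩ := Nat.exists_eq_succ_of_ne_zero h.2.ne'
      have h1 : w i ∈ E.A (w (i + 1)) := (hpar i (by omega)).1
      have h2 : ((E.A (w (i + 1))).erase (w i)).card = 1 := by
        rw [Finset.card_erase_of_mem h1, hcard i (by omega)]
      obtain ⟨z, hz⟩ := Finset.card_eq_one.1 h2
      refine ⟨z, fun _ _ => ⟨?_, ?_⟩⟩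
      · exact Finset.ne_of_mem_erase (hz ▸ Finset.mem_singleton_self z)
      · rw [← Finset.insert_erase h1, hz]; simp
    · exact ⟨w 0, fun h1 h2 => absurd ⟨h1, h2⟩ h⟩
  choose z hz using hz
  have hzne : ∀ i, i < K → z (i + 1) ≠ w i := fun i hi => (hz (i + 1) (by omega) (by omega)).1
  have hA : ∀ i, i < K → E.A (w (i + 1)) = {w i, z (i + 1)} := fun i hi =>
    (hz (i + 1) (by omega) (by omega)).2
  have hordw : ∀ i j, i < j → j < K + 2 → E.ord (w i) < E.ord (w j) := fun i j h h' =>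
    hord _ _ (by omega) (by omega)
  have hstep : ∀ i, i + 1 < K → z (i + 2) = z (i + 1) ∨ z (i + 2) = w i := by
    intro i hi
    have h1 : z (i + 2) ∈ E.A (w (i + 1)) :=
      (hpar (i + 1) (by omega)).mem (by rw [hA (i + 1) hi]; simp) (hzne (i + 1) hi)
    rw [hA i (by omega)] at h1
    simpa [or_comm] using h1
  -- a vertex `d` of `A (w (i + 1))` that is not in `A (w (i + 2))` is adjacent to `w (i + 1)`
  have hthread : ∀ i, i + 1 < K → ∀ d k, E.A (w (i + 1)) = {d, k} → d ≠ k →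
      z (i + 2) = k → H.Adj d (w (i + 1)) := by
    intro i hi d k hdk hne hk
    by_contra hnadj
    have hdA : d ∈ E.A (w (i + 1)) := by rw [hdk]; simp
    have hdlt := E.lt hdA
    have hd1 : d ∉ E.Desc (w (i + 1)) := fun h => absurd (Elimination.ord_le_of_mem_desc h) (not_le.2 hdlt)
    have h := hcut (E.Desc (w (i + 1))) k ⟨w (i + 1), Elimination.mem_desc_self _, by
      rintro h
      have : k ∈ E.A (w (i + 1)) := by rw [hdk]; simp
      rw [← h] at this
      exact absurd (E.lt this) (lt_irrefl _)⟩ ?_ d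
    · exact h.elim hd1 hne
    · intro u hu v huv
      rcases Elimination.adj_desc hu huv with h | h
      · exact Or.inl h
      rw [hdk, Finset.mem_insert, Finset.mem_singleton] at h
      rcases h with rfl | h
      swap
      · exact Or.inr h
      exfalso
      by_cases hu1 : u = w (i + 1)
      · subst hu1; exact hnadj huv.symm
      obtain ⟨x, hx, hux⟩ := Elimination.exists_child_of_mem_desc hu hu1
      obtain rfl := (hw₀ (i + 2) (by omega)).2.2 x hx
      rcases Elimination.adj_desc hux huv with h | h
      · have := Elimination.ord_le_of_mem_desc h
        have := hordw (i + 1) (i + 2) (by omega) (by omega)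
        exact absurd (this.trans_le ‹_›) (not_lt.2 hdlt.le)
      · rw [show w₀ (i + 2 + 1) = w (i + 1 + 1) from rfl, hA (i + 1) hi, hk] at h
        simp only [Finset.mem_insert, Finset.mem_singleton] at h
        rcases h with h | h
        · exact absurd (congrArg E.ord h) hdlt.ne
        · exact hne h
  -- Chain vertices have one child each, so a proper descendant of `w i` is a later chain vertex
  -- before `w j` or a descendant of `w j`.
  have hdesc : ∀ i j, i + 1 ≤ j → j < K + 1 → ∀ u, w i ∈ E.A u →
      (∃ l, i < l ∧ l < j ∧ u = w l) ∨ u ∈ E.Desc (w j) := by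
    intro i j hij
    induction j, hij using Nat.le_induction with
    | base =>
      intro h u hu
      obtain ⟨x, hx, hux⟩ := Elimination.exists_child_of_mem_desc (Elimination.mem_desc_of_mem hu)
        (by rintro rfl; exact absurd (E.lt hu) (lt_irrefl _))
      obtain rfl := (hw₀ (i + 1) (by omega)).2.2 x hx
      exact Or.inr hux
    | succ j hj ih =>
      intro h u hu
      rcases ih (by omega) u hu with ⟨l, h1, h2, h3⟩ | hd
      · exact Or.inl ⟨l, h1, by omega, h3⟩
      · by_cases huj : u = w j
        · exact Or.inl ⟨j, by omega, by omega, huj⟩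
        · obtain ⟨x, hx, hux⟩ := Elimination.exists_child_of_mem_desc hd huj
          obtain rfl := (hw₀ (j + 1) (by omega)).2.2 x hx
          exact Or.inr hux
  refine ⟨z, ⟨?_, hstep, hzne, ?_, ?_, ?_, ?_, ?_⟩⟩
  · intro i j hi hj h
    rcases lt_trichotomy i j with hlt | he | hlt
    · exact absurd (congrArg E.ord h) (hordw i j hlt (by omega)).ne
    · exact he
    · exact absurd (congrArg E.ord h) (hordw j i hlt (by omega)).ne'
  · intro i hi h
    exact hthread i hi (w i) (z (i + 1)) (hA i (by omega)) (hzne i (by omega)).symm h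
  · intro i hi h
    exact hthread i hi (z (i + 1)) (w i) (by rw [hA i (by omega), Finset.pair_comm])
      (hzne i (by omega)) ((hstep i hi).resolve_left h)
  · intro i j hij hj h
    have h1 := E.adj h (hordw i (j + 1) (by omega) (by omega))
    rw [hA j hj, Finset.mem_insert, Finset.mem_singleton] at h1
    refine h1.imp (fun h => ?_) id
    by_contra hne
    exact absurd (congrArg E.ord h) (hordw i j (by omega) (by omega)).ne
  · intro i j hij hj hne u hu
    rcases lt_trichotomy (E.ord u) (E.ord (w (i + 1))) with hlt | he | hlt
    · have h1 := E.adj hu.symm hlt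
      rw [hA i (by omega), Finset.mem_insert, Finset.mem_singleton] at h1
      exact h1.imp id Or.inl
    · exact absurd (E.inj he) hu.ne'
    · have h1 := E.adj hu hlt
      rcases hdesc (i + 1) (j + 1) (by omega) (by omega) u h1 with ⟨l, h2, h3, h4⟩ | h2
      · exact Or.inr (Or.inr ⟨l, h2, by omega, h4⟩)
      · have h3 := Elimination.mem_of_mem_desc h2 h1 (hordw _ _ (by omega) (by omega))
        rw [hA j hj, Finset.mem_insert, Finset.mem_singleton] at h3
        rcases h3 with h3 | h3
        · exact absurd (congrArg E.ord h3) (hordw _ _ hij (by omega)).ne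
        · exact absurd h3 hne
  · intro i hi
    exact hM _ (hw₀ (i + 1) (by omega)).1

end Chain

/-! ### Fans and ladders in a strip -/

section Configurations

variable {W : Type*} {H : SimpleGraph W}

/-- A vertex `x` adjacent to the vertices of a path `v₁ v₂ v₃ v₄`, whose inner vertices have no
further neighbours. -/
structure IsFan (H : SimpleGraph W) (x v₁ v₂ v₃ v₄ : W) : Prop where
  adj₁ : H.Adj x v₁
  adj₄ : H.Adj x v₄
  nbr₂ : ∀ u, H.Adj v₂ u ↔ u = x ∨ u = v₁ ∨ u = v₃
  nbr₃ : ∀ u, H.Adj v₃ u ↔ u = x ∨ u = v₂ ∨ u = v₄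
  ne₁₃ : v₁ ≠ v₃
  ne₁₄ : v₁ ≠ v₄
  ne₂₄ : v₂ ≠ v₄

/-- `l < i`, and no index strictly between has the colour of `l`. -/
def Prec (c : ℕ → Bool) (l i : ℕ) : Prop := l < i ∧ ∀ k, l < k → k < i → c k ≠ c l

/-- The indices `k` between `a 0` and `a 8`, if `k` is coloured `true`, or between `b 0` and `b 8`,
if it is coloured `false`. -/
def LadderIndex (c : ℕ → Bool) (a b : Fin 9 → ℕ) (k : ℕ) : Prop :=
  (c k = true ∧ a 0 ≤ k ∧ k ≤ a 8) ∨ (c k = false ∧ b 0 ≤ k ∧ k ≤ b 8)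

/-- The vertices `w k`, for the indices `k` of one colour, form an induced path, and the path
for the colour `true` and the path for the colour `false` are the sides of a ladder with the rungs
`w (a t)`, `w (b t)`. -/
structure IsLadder (H : SimpleGraph W) (K : ℕ) (w : ℕ → W) (c : ℕ → Bool) (a b : Fin 9 → ℕ) :
    Prop where
  mono_a : StrictMono a
  mono_b : StrictMono b
  color_a : ∀ t, c (a t) = true
  color_b : ∀ t, c (b t) = false
  lt_a : ∀ t, a t < K
  lt_b : ∀ t, b t < K
  inj : ∀ i j, i < K → j < K → w i = w j → i = j
  path : ∀ i j, LadderIndex c a b i → LadderIndex c a b j → c i = c j → i < j →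
    (H.Adj (w i) (w j) ↔ Prec c i j)
  rung : ∀ t, H.Adj (w (a t)) (w (b t))
  nbr : ∀ k, LadderIndex c a b k → k ≠ a 0 → k ≠ a 8 → k ≠ b 0 → k ≠ b 8 →
    ∀ u, H.Adj (w k) u → ∃ l, LadderIndex c a b l ∧ u = w l

variable {K : ℕ} {w z : ℕ → W}

theorem adj_iff_of_ncard [Finite W] {v a b c : W} (hsub : ∀ u, H.Adj v u → u = a ∨ u = b ∨ u = c)
    (hdeg : 2 < (H.neighborSet v).ncard) (u : W) : H.Adj v u ↔ u = a ∨ u = b ∨ u = c := by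
  have h1 : H.neighborSet v = {a, b, c} := by
    refine Set.eq_of_subset_of_ncard_le (fun u hu => hsub u hu) ?_ (Set.toFinite _)
    have h2 := Set.ncard_insert_le a {b, c}
    have h3 := Set.ncard_insert_le b {c}
    rw [Set.ncard_singleton] at h3
    omega
  rw [← SimpleGraph.mem_neighborSet, h1]
  rfl

namespace IsStrip

/-- While `z` is constant, a vertex of the strip can only be adjacent to `z` and to its predecessor
and successor in the chain. Degree three forces all these edges, so `z` is the centre of a fan. -/
theorem exists_isFan [Finite W] (h : IsStrip H K w z) {a : ℕ} (ha : a + 5 < K)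
    (hz : ∀ i ≤ 5, z (a + 1 + i) = z (a + 1)) : ∃ x i, i + 4 ≤ K ∧
      IsFan H x (w i) (w (i + 1)) (w (i + 2)) (w (i + 3)) := by
  have hnb : ∀ i, i ≤ 3 → ∀ u, H.Adj (w (a + i + 1)) u ↔
      u = z (a + 1) ∨ u = w (a + i) ∨ u = w (a + i + 2) := by
    intro i hi
    refine adj_iff_of_ncard (fun u hu => ?_) (h.deg _ (by omega))
    have hne : w (a + i + 1) ≠ z (a + i + 2 + 1) := by
      rw [show a + i + 2 + 1 = a + 1 + (i + 2) by omega, hz _ (by omega),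
        ← hz (i + 1) (by omega), show a + 1 + (i + 1) = a + i + 1 + 1 by omega]
      exact (h.z_ne _ (by omega)).symm
    rcases h.nbr (a + i) (a + i + 2) (by omega) (by omega) hne u hu with h1 | h1 | ⟨l, h1, h2, h3⟩
    · exact Or.inr (Or.inl h1)
    · rw [show a + i + 1 = a + 1 + i by omega, hz i (by omega)] at h1; exact Or.inl h1
    · obtain rfl : l = a + i + 2 := by omega
      exact Or.inr (Or.inr h3)
  have ne : ∀ i j, i ≤ 5 → j ≤ 5 → i ≠ j → w (a + i) ≠ w (a + j) := fun i j hi hj hij he =>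
    hij (by have := h.inj _ _ (by omega) (by omega) he; omega)
  exact ⟨z (a + 1), a + 1, by omega, ((hnb 0 (by omega) _).2 (Or.inl rfl)).symm,
    ((hnb 3 (by omega) _).2 (Or.inl rfl)).symm, hnb 1 (by omega), hnb 2 (by omega),
    ne 1 3 (by omega) (by omega) (by omega), ne 1 4 (by omega) (by omega) (by omega),
    ne 2 4 (by omega) (by omega) (by omega)⟩

/-- Data extracted from a strip without long fans: a colouring of the indices, such that `w i` is
adjacent to at most the last earlier vertices of the two colours. -/
structure Coloring (H : SimpleGraph W) (K : ℕ) (w : ℕ → W) (c : ℕ → Bool) : Prop where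
  inj : ∀ i j, i ≤ K → j ≤ K → w i = w j → i = j
  window : ∀ a, a + 6 ≤ K → ∃ i j, a ≤ i ∧ i < a + 6 ∧ a ≤ j ∧ j < a + 6 ∧ c i ≠ c j
  prec_of_adj : ∀ i j, i < j → 7 ≤ j → j < K → H.Adj (w i) (w j) → Prec c i j
  thread : ∀ i j, 7 ≤ j → j + 1 < K → Prec c i j → c i = c j → H.Adj (w i) (w j)
  nbr : ∀ i, 7 ≤ i → i + 7 < K → ∀ u, H.Adj (w i) u → ∃ l, l ≤ i + 6 ∧ u = w l
  deg : ∀ i, i ≤ K → 2 < (H.neighborSet (w i)).ncard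

open Classical in
-- The colour flips exactly when `z` changes. From the first change on, `w j` and `z (j + 1)` are
-- the last vertices of the two colours up to `j`, so `w (j + 1)` has no other earlier neighbours,
-- and the thread edges join consecutive vertices of the same colour. Without fans, `z` changes
-- among any five consecutive steps, so six consecutive indices show both colours; the thresholds 6
-- and 7 stay clear of the stretch before the first change.
theorem exists_coloring [Finite W] (h : IsStrip H K w z) (hK : 8 ≤ K)
    (hfan : ¬ ∃ x i, i + 4 ≤ K ∧ IsFan H x (w i) (w (i + 1)) (w (i + 2)) (w (i + 3))) :
    ∃ c, Coloring H K w c := by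
  let c : ℕ → Bool := fun i => Nat.rec false
    (fun i b => if z (i + 2) = z (i + 1) then b else !b) i
  have hc : ∀ i, c (i + 1) = if z (i + 2) = z (i + 1) then c i else !(c i) := fun i => rfl
  have hsw : ∀ a, a + 5 < K → ∃ i, a ≤ i ∧ i < a + 5 ∧ z (i + 2) ≠ z (i + 1) := by
    intro a ha
    by_contra hno
    push Not at hno
    refine hfan (h.exists_isFan ha fun i => ?_)
    induction i with
    | zero => intro _; rfl
    | succ i ih =>
      intro hi
      rw [← ih (by omega), ← add_assoc, show a + 1 + i + 1 = a + i + 2 by omega,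
        show a + 1 + i = a + i + 1 by omega]
      exact hno (a + i) (by omega) (by omega)
  have hcs : ∀ i, z (i + 2) ≠ z (i + 1) → c (i + 1) ≠ c i := by
    intro i hi; rw [hc, if_neg hi]; cases c i <;> simp
  have hwin : ∀ a, a + 6 ≤ K → ∃ i j, a ≤ i ∧ i < a + 6 ∧ a ≤ j ∧ j < a + 6 ∧ c i ≠ c j := by
    intro a ha
    obtain ⟨i, h1, h2, h3⟩ := hsw a (by omega)
    exact ⟨i + 1, i, by omega, by omega, by omega, by omega, hcs i h3⟩
  obtain ⟨s, -, hs, hsz⟩ := hsw 0 (by omega)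
  -- `z (j + 1)` is the vertex of the last index before `j` whose colour differs from that of `j`.
  have hlast : ∀ j, s + 1 ≤ j → j < K → ∃ l, l < j ∧ z (j + 1) = w l ∧ c l ≠ c j ∧
      ∀ k, l < k → k ≤ j → c k = c j := by
    intro j hj
    induction j, hj using Nat.le_induction with
    | base =>
      intro hK'
      refine ⟨s, by omega, (h.step s hK').resolve_left hsz, (hcs s hsz).symm, fun k h1 h2 => ?_⟩
      rw [show k = s + 1 by omega]
    | succ j hj ih =>
      intro hK'
      by_cases he : z (j + 2) = z (j + 1)
      · obtain ⟨l, h1, h2, h3, h4⟩ := ih (by omega)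
        have hcj : c (j + 1) = c j := by rw [hc, if_pos he]
        refine ⟨l, by omega, he.trans h2, by rwa [hcj], fun k h5 h6 => ?_⟩
        rcases Nat.lt_or_ge j k with h7 | h7
        · rw [show k = j + 1 by omega]
        · rw [hcj]; exact h4 k h5 h7
      · refine ⟨j, by omega, (h.step j hK').resolve_left he, (hcs j he).symm, fun k h5 h6 => ?_⟩
        rw [show k = j + 1 by omega]
  have hprec : ∀ j, 6 ≤ j → j < K → ∃ l, z (j + 1) = w l ∧ Prec c l (j + 1) ∧ c l ≠ c j := by
    intro j hj hjK
    obtain ⟨l, h1, h2, h3, h4⟩ := hlast j (by omega) hjK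
    exact ⟨l, h2, ⟨by omega, fun k h5 h6 => by rw [h4 k h5 (by omega)]; exact h3.symm⟩, h3⟩
  refine ⟨c, h.inj, hwin, ?_, ?_, ?_, h.deg⟩
  · intro i j hij hj hjK hadj
    obtain ⟨j, rfl⟩ := Nat.exists_eq_succ_of_ne_zero (show j ≠ 0 by omega)
    rcases h.back i j (by omega) (by omega) hadj with rfl | h1
    · exact ⟨hij, fun k h1 h2 => by omega⟩
    · obtain ⟨l, h2, h3, -⟩ := hprec j (by omega) (by omega)
      obtain rfl := h.inj i l (by omega) (by have := h3.1; omega) (h1.trans h2)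
      exact h3
  · intro i j hj hjK hp hcc
    obtain ⟨j, rfl⟩ := Nat.exists_eq_succ_of_ne_zero (show j ≠ 0 by omega)
    rw [Nat.succ_eq_add_one] at *
    have hij := hp.1
    by_cases he : z (j + 2) = z (j + 1)
    · have hcj : c (j + 1) = c j := by rw [hc, if_pos he]
      obtain rfl : i = j := by
        by_contra hne
        exact hp.2 j (by omega) (by omega) (hcj.symm.trans hcc.symm)
      exact h.thread i (by omega) he
    · obtain ⟨l, h2, h3, h4⟩ := hprec j (by omega) (by omega)
      have h5 := h.thread' j (by omega) he
      have h6 := hcs j he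
      have h7 : c l = c i := by
        revert h4 h6; rw [← hcc]; cases c l <;> cases c i <;> cases c j <;> simp
      have hl := h3.1
      obtain rfl : i = l := by
        rcases lt_trichotomy i l with h8 | h8 | h8
        · exact absurd h7 (hp.2 l h8 hl)
        · exact h8
        · exact absurd h7.symm (h3.2 i h8 hij)
      rwa [← h2]
  · intro i hi hiK u hu
    obtain ⟨i, rfl⟩ := Nat.exists_eq_succ_of_ne_zero (show i ≠ 0 by omega)
    rw [Nat.succ_eq_add_one] at *
    -- Equality would make the six indices from `i + 2` to `i + 7` all differ in colour from `i +
    -- 1`.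
    have hne : w (i + 1) ≠ z (i + 7 + 1) := by
      intro he
      obtain ⟨l, h2, h3, h4⟩ := hprec (i + 7) (by omega) (by omega)
      have := h3.1
      obtain rfl := h.inj (i + 1) l (by omega) (by omega) (he.trans h2)
      obtain ⟨x, y, h5, h6, h7, h8, h9⟩ := hwin (i + 2) (by omega)
      have h10 := h3.2 x (by omega) (by omega)
      have h11 := h3.2 y (by omega) (by omega)
      revert h9 h10 h11
      cases c x <;> cases c y <;> cases c (i + 1) <;> simp
    rcases h.nbr i (i + 7) (by omega) (by omega) hne u hu with h1 | h1 | ⟨l, h1, h2, h3⟩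
    · exact ⟨i, by omega, h1⟩
    · obtain ⟨l, h2, h3, -⟩ := hprec i (by omega) (by omega)
      exact ⟨l, by have := h3.1; omega, h1.trans h2⟩
    · exact ⟨l, by omega, h3⟩

end IsStrip

end Configurations

/-! ### Rungs of a two-coloured strip, and the ladder they form. -/

section Ladders

variable {W : Type*} {H : SimpleGraph W} {K : ℕ} {w : ℕ → W} {c : ℕ → Bool}

theorem Prec.eq_of_left {l l' i : ℕ} (h : Prec c l i) (h' : Prec c l' i) (hc : c l = c l') :
    l = l' := by
  rcases lt_trichotomy l l' with h1 | h1 | h1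
  · exact absurd hc.symm (h.2 _ h1 h'.1)
  · exact h1
  · exact absurd hc (h'.2 _ h1 h.1)

theorem Prec.eq_of_right {l l' i : ℕ} (h : Prec c i l) (h' : Prec c i l') (hc : c l = c i)
    (hc' : c l' = c i) : l = l' := by
  rcases lt_trichotomy l l' with h1 | h1 | h1
  · exact absurd hc (h'.2 _ h.1 h1)
  · exact h1
  · exact absurd hc' (h.2 _ h'.1 h1)

/-- An edge may not skip an index of the colour of its earlier end. A neighbour lying beyond one of
the end rungs would make either its own edge or that rung do so; the end rungs are barriers. -/
theorem ladderIndex_aux {a₀ a₈ b₀ b₈ k l : ℕ} {x : Bool} (ha₀ : c a₀ = x) (ha₈ : c a₈ = x)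
    (hb₀ : c b₀ = !x) (hb₈ : c b₈ = !x) (hk : c k = x) (h₀ : a₀ < k) (h₈ : k < a₈)
    (r₀ : Prec c a₀ b₀ ∨ Prec c b₀ a₀) (r₈ : Prec c a₈ b₈ ∨ Prec c b₈ a₈)
    (hl : Prec c l k ∨ Prec c k l) :
    (c l = x ∧ a₀ ≤ l ∧ l ≤ a₈) ∨ (c l = !x ∧ b₀ ≤ l ∧ l ≤ b₈) := by
  have hx : x ≠ !x := by cases x <;> simp
  have e {i j : ℕ} (hi : c i = x) (hj : c j = !x) : i ≠ j := by
    rintro rfl; exact hx (hi.symm.trans hj)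
  by_cases hcl : c l = x
  · refine Or.inl ⟨hcl, ?_, ?_⟩ <;> by_contra hcon
    · rcases hl with hl | hl
      · exact hl.2 a₀ (by omega) h₀ (ha₀.trans hcl.symm)
      · have := hl.1; omega
    · rcases hl with hl | hl
      · have := hl.1; omega
      · exact hl.2 a₈ h₈ (by omega) (ha₈.trans hk.symm)
  · have hcl : c l = !x := by revert hcl; cases c l <;> cases x <;> simp
    have e1 := e hk hb₀
    have e2 := e ha₈ hcl
    refine Or.inr ⟨hcl, ?_, ?_⟩ <;> by_contra hcon
    · by_cases hb : k < b₀
      · rcases r₀ with r | r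
        · exact r.2 k h₀ hb (hk.trans ha₀.symm)
        · have := r.1; omega
      · rcases hl with hl | hl
        · exact hl.2 b₀ (by omega) (by omega) (hb₀.trans hcl.symm)
        · have := hl.1; omega
    · by_cases hb : l < a₈
      · rcases r₈ with r | r
        · have := r.1; omega
        · exact r.2 l (by omega) hb (hcl.trans hb₈.symm)
      · rcases hl with hl | hl
        · have := hl.1; omega
        · exact hl.2 a₈ h₈ (by omega) (ha₈.trans hk.symm)

namespace IsStrip.Coloring

theorem prec_or_prec (h : Coloring H K w c) {i l : ℕ} (hi : 7 ≤ i) (hiK : i < K) (hlK : l < K)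
    (hadj : H.Adj (w i) (w l)) : Prec c l i ∨ Prec c i l := by
  rcases lt_trichotomy l i with h1 | rfl | h1
  · exact Or.inl (h.prec_of_adj l i h1 hi hiK hadj.symm)
  · exact absurd rfl hadj.ne
  · exact Or.inr (h.prec_of_adj i l h1 (by omega) hlK hadj)

/-- Among the neighbours of `w i` with the colour of `i`, at most one comes before it and at most
one after it. The third neighbour has the other colour. -/
theorem exists_rung [Finite W] (h : Coloring H K w c) {i : ℕ} (hi : 7 ≤ i) (hiK : i + 7 < K) :
    ∃ l, l ≤ i + 6 ∧ i ≤ l + 6 ∧ c l ≠ c i ∧ H.Adj (w i) (w l) := by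
  obtain ⟨l, hl, hc, hadj⟩ : ∃ l, l ≤ i + 6 ∧ c l ≠ c i ∧ H.Adj (w i) (w l) := by
    by_contra hno
    push Not at hno
    obtain ⟨u₁, h₁, u₂, h₂, u₃, h₃, h₁₂, h₁₃, h₂₃⟩ :=
      (Set.two_lt_ncard (Set.toFinite _)).1 (h.deg i (by omega))
    obtain ⟨l₁, g₁, rfl⟩ := h.nbr i hi hiK u₁ h₁
    obtain ⟨l₂, g₂, rfl⟩ := h.nbr i hi hiK u₂ h₂
    obtain ⟨l₃, g₃, rfl⟩ := h.nbr i hi hiK u₃ h₃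
    have c₁ : c l₁ = c i := not_not.1 fun hc => hno l₁ g₁ hc h₁
    have c₂ : c l₂ = c i := not_not.1 fun hc => hno l₂ g₂ hc h₂
    have c₃ : c l₃ = c i := not_not.1 fun hc => hno l₃ g₃ hc h₃
    have key : ∀ l l', w l ≠ w l' → c l = c i → c l' = c i → Prec c l i → ¬ Prec c l' i :=
      fun l l' hne e e' p p' => hne (congrArg w (p.eq_of_left p' (e.trans e'.symm)))
    have key' : ∀ l l', w l ≠ w l' → c l = c i → c l' = c i → Prec c i l → ¬ Prec c i l' :=
      fun l l' hne e e' p p' => hne (congrArg w (p.eq_of_right p' e e'))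
    rcases h.prec_or_prec hi (by omega) (by omega) h₁ with p₁ | p₁ <;>
    rcases h.prec_or_prec hi (by omega) (by omega) h₂ with p₂ | p₂ <;>
    rcases h.prec_or_prec hi (by omega) (by omega) h₃ with p₃ | p₃ <;>
    first
      | exact key _ _ h₁₂ c₁ c₂ p₁ p₂
      | exact key _ _ h₁₃ c₁ c₃ p₁ p₃
      | exact key _ _ h₂₃ c₂ c₃ p₂ p₃
      | exact key' _ _ h₁₂ c₁ c₂ p₁ p₂
      | exact key' _ _ h₁₃ c₁ c₃ p₁ p₃
      | exact key' _ _ h₂₃ c₂ c₃ p₂ p₃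
  refine ⟨l, hl, ?_, hc, hadj⟩
  -- An edge reaching back more than six steps would skip six indices, among them one of the colour
  -- of `l`.
  by_contra hlt
  rcases h.prec_or_prec hi (by omega) (by omega) hadj with p | p
  · obtain ⟨x, y, h5, h6, h7, h8, h9⟩ := h.window (i - 6) (by omega)
    have h10 := p.2 x (by omega) (by omega)
    have h11 := p.2 y (by omega) (by omega)
    revert h9 h10 h11
    cases c x <;> cases c y <;> cases c l <;> simp
  · have := p.1; omega

theorem exists_isLadder [Finite W] (h : Coloring H K w c) (hK : 200 ≤ K) :
    ∃ a b, IsLadder H K w c a b := by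
  -- Nine rungs based at distance 20. Each spans at most 6 indices to either side, so they occupy
  -- disjoint intervals from 14 to 186, inside the strip and away from its irregular ends.
  have hr : ∀ t : Fin 9, ∃ l, l ≤ 20 + 20 * (t : ℕ) + 6 ∧ 20 + 20 * (t : ℕ) ≤ l + 6 ∧
      c l ≠ c (20 + 20 * t) ∧ H.Adj (w (20 + 20 * t)) (w l) := fun t =>
    h.exists_rung (by omega) (by omega)
  choose l hl₁ hl₂ hlc hadj using hr
  let a : Fin 9 → ℕ := fun t => if c (20 + 20 * t) = true then 20 + 20 * t else l t
  let b : Fin 9 → ℕ := fun t => if c (20 + 20 * t) = true then l t else 20 + 20 * t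
  have hab : ∀ t, c (a t) = true ∧ c (b t) = false ∧ H.Adj (w (a t)) (w (b t)) ∧
      14 + 20 * (t : ℕ) ≤ a t ∧ a t ≤ 26 + 20 * t ∧ 14 + 20 * (t : ℕ) ≤ b t ∧ b t ≤ 26 + 20 * t := by
    intro t
    have h1 := hl₁ t
    have h2 := hl₂ t
    have h3 := hlc t
    by_cases ht : c (20 + 20 * t) = true
    · simp only [a, b, if_pos ht]
      rw [ht] at h3
      exact ⟨ht, by simpa using h3, hadj t, by omega, by omega, by omega, by omega⟩
    · simp only [a, b, if_neg ht]
      rw [Bool.not_eq_true] at ht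
      rw [ht] at h3
      exact ⟨by simpa using h3, ht, (hadj t).symm, by omega, by omega, by omega, by omega⟩
  have hidx : ∀ k, LadderIndex c a b k → 14 ≤ k ∧ k ≤ 186 := by
    intro k hk
    have h0 := (hab 0).2.2.2
    have h8 := (hab 8).2.2.2
    simp only [Fin.coe_ofNat_eq_mod] at h0 h8
    rcases hk with hk | hk <;> omega
  have hrung : ∀ t, Prec c (a t) (b t) ∨ Prec c (b t) (a t) := fun t =>
    (h.prec_or_prec (by have := (hab t).2.2.2; omega) (by have := (hab t).2.2.2; omega)
      (by have := (hab t).2.2.2; omega) (hab t).2.2.1).symm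
  refine ⟨a, b, ⟨fun t t' ht => ?_, fun t t' ht => ?_, fun t => (hab t).1, fun t => (hab t).2.1,
    fun t => ?_, fun t => ?_, fun i j hi hj => h.inj i j hi.le hj.le, ?_, fun t => (hab t).2.2.1, ?_⟩⟩
  · have h1 := (hab t).2.2.2
    have h2 := (hab t').2.2.2
    have : (t : ℕ) < t' := ht
    omega
  · have h1 := (hab t).2.2.2
    have h2 := (hab t').2.2.2
    have : (t : ℕ) < t' := ht
    omega
  · have := (hab t).2.2.2; omega
  · have := (hab t).2.2.2; omega
  · intro i j hi hj hc hij
    have h1 := hidx j hj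
    exact ⟨h.prec_of_adj i j hij (by omega) (by omega),
      fun hp => h.thread i j (by omega) (by omega) hp hc⟩
  · intro k hk k₁ k₂ k₃ k₄ u hu
    have h1 := hidx k hk
    obtain ⟨m, hm, rfl⟩ := h.nbr k (by omega) (by omega) u hu
    refine ⟨m, ?_, rfl⟩
    have hp := h.prec_or_prec (by omega) (by omega) (by omega) hu
    rcases hk with ⟨hk, h2, h3⟩ | ⟨hk, h2, h3⟩
    · exact ladderIndex_aux (x := true) (hab 0).1 (hab 8).1 (hab 0).2.1 (hab 8).2.1 hk (by omega)
        (by omega) (hrung 0) (hrung 8) hp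
    · exact (ladderIndex_aux (x := false) (hab 0).2.1 (hab 8).2.1 (hab 0).1 (hab 8).1 hk (by omega)
        (by omega) (hrung 0).symm (hrung 8).symm hp).symm

end IsStrip.Coloring

end Ladders

/-! ### Fans and ladders admit the reductions -/

section Soundness

variable {V : Type*} {G : SimpleGraph V}

theorem isComponentOfDelete_of_closed {U C : Set V} (hC : (G.induce C).Connected) (hU : C ⊆ Uᶜ)
    (hcl : ∀ u ∈ C, ∀ v ∉ U, G.Adj u v → v ∈ C) : IsComponentOfDelete G U C := by
  obtain ⟨⟨a, ha⟩⟩ := hC.nonempty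
  refine ⟨(G.induce Uᶜ).connectedComponentMk ⟨a, hU ha⟩, Set.Subset.antisymm ?_ ?_⟩
  · intro b hb
    refine ⟨⟨b, hU hb⟩, SimpleGraph.ConnectedComponent.sound ?_, rfl⟩
    exact (hC.preconnected ⟨b, hb⟩ ⟨a, ha⟩).map (SimpleGraph.induceHomOfLE G hU).toHom
  · rintro _ ⟨b, hb, rfl⟩
    obtain ⟨p⟩ := (SimpleGraph.ConnectedComponent.exact hb).symm
    suffices ∀ (x y : (Uᶜ : Set V)) (p : (G.induce Uᶜ).Walk x y), (x : V) ∈ C → (y : V) ∈ C from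
      this _ _ p ha
    intro x y p
    induction p with
    | nil => exact id
    | @cons x y z h _ ih => exact fun hx => ih (hcl _ hx _ y.2 h)

theorem IsTidyModulator.insert [Finite V] {X : Set V} (hX : IsTidyModulator G X) {x : V}
    (hx : x ∉ X) : IsTidyModulator G (insert x X) := by
  refine ⟨hX.1.induce_mono (Set.compl_subset_compl.2 (Set.subset_insert _ _)), ?_⟩
  rintro y (rfl | hy)
  · refine hX.1.induce_mono (Set.compl_subset_compl.2 fun z hz => ⟨Or.inr hz, ?_⟩)
    rintro rfl; exact hx hz
  · exact (hX.2 y hy).induce_mono (Set.compl_subset_compl.2 fun z hz => ⟨Or.inr hz.1, hz.2⟩)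

/-- The modulator is `insert x X`, tidy because removing `x` gives back `X`. The component `{v₂,
v₃}` has only `x` as a neighbour in it, so the limit-1 condition holds for every set `S`, whether a
solution or not. -/
theorem IsFan.removes [Finite V] {X : Set V} (hX : IsTidyModulator G X) {x v₁ v₂ v₃ v₄ : V}
    (h : IsFan G x v₁ v₂ v₃ v₄) (hx : x ∉ X) (h₁ : v₁ ∉ X) (h₂ : v₂ ∉ X) (h₃ : v₃ ∉ X)
    (h₄ : v₄ ∉ X) (t : ℕ) : FrequentPathNeighbourRemoves G t s(v₂, x) := by
  have a₂ : G.Adj v₂ x := (h.nbr₂ x).2 (Or.inl rfl)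
  have a₃ : G.Adj v₃ x := (h.nbr₃ x).2 (Or.inl rfl)
  have a₁₂ : G.Adj v₁ v₂ := ((h.nbr₂ v₁).2 (Or.inr (Or.inl rfl))).symm
  have a₂₃ : G.Adj v₂ v₃ := (h.nbr₂ v₃).2 (Or.inr (Or.inr rfl))
  have a₃₄ : G.Adj v₃ v₄ := (h.nbr₃ v₄).2 (Or.inr (Or.inr rfl))
  have n₁₂ := a₁₂.ne
  have n₂₃ := a₂₃.ne
  have n₃₄ := a₃₄.ne
  have n₁₃ := h.ne₁₃
  have n₁₄ := h.ne₁₄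
  have n₂₄ := h.ne₂₄
  have nx₁ := h.adj₁.ne
  have nx₂ := a₂.ne'
  have nx₃ := a₃.ne'
  have nx₄ := h.adj₄.ne
  let P : G.Walk v₁ v₄ := .cons a₁₂ (.cons a₂₃ (.cons a₃₄ .nil))
  have hPs : P.support = [v₁, v₂, v₃, v₄] := rfl
  have hC : ∀ u ∈ ({v₂, v₃} : Set V), ∀ v, G.Adj u v → v = x ∨ v = v₁ ∨ v = v₄ ∨ v ∈ ({v₂, v₃} : Set V) := by
    rintro u (rfl | rfl) v huv
    · rcases (h.nbr₂ v).1 huv with h | h | h <;> simp [h]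
    · rcases (h.nbr₃ v).1 huv with h | h | h <;> simp [h]
  refine ⟨insert x X, x, v₁, v₄, v₁, v₂, v₃, v₄, P, {v₂, v₃}, hX.insert hx, Set.mem_insert _ _,
    ?_, ?_, ?_, h.adj₁, a₂.symm, a₃.symm, h.adj₄, ?_, ?_, ?_, rfl⟩
  · rw [SimpleGraph.Walk.isPath_def, hPs]
    simp [n₁₂, n₁₃, n₁₄, n₂₃, n₂₄, n₃₄]
  · intro w hw
    rw [hPs] at hw
    simp only [List.mem_cons, List.not_mem_nil, or_false] at hw
    rcases hw with rfl | rfl | rfl | rfl <;> simp [*, Ne.symm]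
  · rw [hPs]
  · refine isComponentOfDelete_of_closed (SimpleGraph.induce_pair_connected_of_adj a₂₃) ?_ ?_
    · rintro u (rfl | rfl)
      · simp [*, nx₂.symm, n₁₂.symm]
      · simp [*, nx₃.symm, n₁₃.symm]
    · intro u hu v hv huv
      rcases hC u hu v huv with rfl | rfl | rfl | h
      · simp at hv
      · simp at hv
      · simp at hv
      · exact h
  · intro w hw
    rw [hPs] at hw
    have hnd : [v₁, w, v₄].Nodup := hw.nodup (by simp [n₁₂, n₁₃, n₁₄, n₂₃, n₂₄, n₃₄])
    have hmem := hw.subset (show w ∈ [v₁, w, v₄] by simp)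
    simp only [List.mem_cons, List.not_mem_nil, or_false, List.nodup_cons] at hmem hnd
    rcases hmem with rfl | rfl | rfl | rfl
    · simp at hnd
    · simp
    · simp
    · simp at hnd
  · intro S _
    have hsub : (openNbhd G {v₂, v₃} ∩ insert x X) \ (S : Set V) ⊆ {x} := by
      rintro w ⟨⟨⟨hw, u, hu, huw⟩, hwX⟩, -⟩
      rcases hwX with rfl | hwX
      · rfl
      · rcases hC u hu w huw with rfl | rfl | rfl | h
        · rfl
        · exact absurd hwX h₁
        · exact absurd hwX h₄
        · exact absurd h hw
    exact (Set.ncard_le_ncard hsub (Set.toFinite _)).trans (by rw [Set.ncard_singleton])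

/-- A sorted list of indices of which exactly the consecutive ones give adjacent vertices
describes an induced path. -/
theorem exists_induced_walk {l : List ℕ} (hne : l ≠ []) (hs : l.Pairwise (· < ·)) {w : ℕ → V}
    (hinj : ∀ i ∈ l, ∀ j ∈ l, w i = w j → i = j)
    (hadj : ∀ i ∈ l, ∀ j ∈ l, i < j → (G.Adj (w i) (w j) ↔ ∀ k ∈ l, ¬ (i < k ∧ k < j))) :
    ∃ (a b : V) (P : G.Walk a b), P.support = l.map w ∧ P.IsPath ∧ P.toSubgraph.IsInduced := by
  have hget : ∀ (i j : ℕ) (hi : i < l.length) (hj : j < l.length), l[i] < l[j] ↔ i < j := by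
    intro i j hi hj
    have hmono := List.pairwise_iff_getElem.1 hs
    constructor
    · intro h
      by_contra hij
      rcases Nat.lt_or_ge j i with h' | h'
      · have := hmono j i hj hi h'; omega
      · obtain rfl : i = j := by omega
        exact absurd h (lt_irrefl _)
    · exact hmono i j hi hj
  have hchain : (l.map w).IsChain G.Adj := by
    rw [List.isChain_iff_getElem]
    intro i hi
    rw [List.length_map] at hi
    rw [List.getElem_map, List.getElem_map]
    refine (hadj _ (List.getElem_mem _) _ (List.getElem_mem _)
      ((hget i (i + 1) (by omega) hi).2 (by omega))).2 fun k hk => ?_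
    obtain ⟨m, hm, rfl⟩ := List.getElem_of_mem hk
    rw [hget i m (by omega) hm, hget m (i + 1) hm hi]
    omega
  have hne' : l.map w ≠ [] := by simpa using hne
  set P := SimpleGraph.Walk.ofSupport (l.map w) hne' hchain with hP
  have hPs : P.support = l.map w := SimpleGraph.Walk.support_ofSupport hne' hchain
  have hPl : P.length + 1 = l.length := by
    rw [← SimpleGraph.Walk.length_support, hPs, List.length_map]
  refine ⟨_, _, P, hPs, ?_, ?_⟩
  · rw [SimpleGraph.Walk.isPath_def, hPs]
    exact List.Nodup.map_on (fun i hi j hj => hinj i hi j hj) (hs.imp fun h => h.ne)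
  · have hget' : ∀ (i : ℕ) (hi : i < l.length), P.getVert i = w l[i] := by
      intro i hi
      rw [SimpleGraph.Walk.getVert_eq_support_getElem P (by omega)]
      simp [hPs]
    have key : ∀ (i j : ℕ) (hi : i < l.length) (hj : j < l.length), i < j →
        G.Adj (w l[i]) (w l[j]) → P.toSubgraph.Adj (w l[i]) (w l[j]) := by
      intro i j hi hj hij h
      have h1 := (hadj _ (List.getElem_mem hi) _ (List.getElem_mem hj) ((hget i j hi hj).2 hij)).1 h
      -- An entry of the list between the two would violate `hadj`, so an edge between listed
      -- vertices is an edge of the walk.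
      obtain rfl : j = i + 1 := by
        by_contra hne
        exact h1 l[i + 1] (List.getElem_mem _) ⟨(hget i (i + 1) hi (by omega)).2 (by omega),
          (hget (i + 1) j (by omega) hj).2 (by omega)⟩
      have h2 := P.toSubgraph_adj_getVert (i := i) (by omega)
      rwa [hget' i hi, hget' (i + 1) hj] at h2
    intro u hu v hv huv
    rw [SimpleGraph.Walk.mem_verts_toSubgraph, hPs, List.mem_map] at hu hv
    obtain ⟨i, hi, rfl⟩ := hu
    obtain ⟨j, hj, rfl⟩ := hv
    obtain ⟨i, hi', rfl⟩ := List.getElem_of_mem hi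
    obtain ⟨j, hj', rfl⟩ := List.getElem_of_mem hj
    rcases lt_trichotomy i j with h | rfl | h
    · exact key i j hi' hj' h huv
    · exact absurd rfl huv.ne
    · exact (key j i hj' hi' h huv.symm).symm

theorem ofFn_sublist {l : List ℕ} (hs : l.Pairwise (· < ·)) {a : Fin 9 → ℕ} (ha : StrictMono a)
    (hmem : ∀ t, a t ∈ l) : (List.ofFn a).Sublist l := by
  have h1 : (List.ofFn a).Pairwise (· < ·) := List.pairwise_ofFn.2 fun i j h => ha h
  refine List.sublist_of_subperm_of_pairwise (r := (· < ·)) ?_ h1 hs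
  refine List.subperm_of_subset (h1.imp fun h => h.ne) fun x hx => ?_
  obtain ⟨t, rfl⟩ := List.mem_ofFn.1 hx
  exact hmem t

variable {K : ℕ} {w : ℕ → V} {c : ℕ → Bool} {a b : Fin 9 → ℕ}

/-- The indices of one colour between `lo` and `hi`. -/
def sideList (c : ℕ → Bool) (x : Bool) (lo hi : ℕ) : List ℕ :=
  (List.range (hi + 1)).filter fun k => c k = x ∧ lo ≤ k

theorem mem_sideList {x : Bool} {lo hi k : ℕ} :
    k ∈ sideList c x lo hi ↔ c k = x ∧ lo ≤ k ∧ k ≤ hi := by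
  simp only [sideList, List.mem_filter, List.mem_range, decide_eq_true_eq]
  constructor
  · rintro ⟨h1, h2, h3⟩; exact ⟨h2, h3, by omega⟩
  · rintro ⟨h1, h2, h3⟩; exact ⟨by omega, h1, h2⟩

theorem sideList_sorted (x : Bool) (lo hi : ℕ) : (sideList c x lo hi).Pairwise (· < ·) :=
  List.Pairwise.filter _ List.pairwise_lt_range

theorem IsLadder.exists_side (h : IsLadder G K w c a b) (x : Bool) (d : Fin 9 → ℕ)
    (hd : StrictMono d) (hc : ∀ t, c (d t) = x)
    (hidx : ∀ k, c k = x → d 0 ≤ k → k ≤ d 8 → LadderIndex c a b k ∧ k < K) :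
    ∃ (u v : V) (P : G.Walk u v), P.support = (sideList c x (d 0) (d 8)).map w ∧ P.IsPath ∧
      P.toSubgraph.IsInduced ∧ (List.ofFn fun t => w (d t)).Sublist P.support := by
  have hdm : ∀ t, d t ∈ sideList c x (d 0) (d 8) := fun t =>
    mem_sideList.2 ⟨hc t, hd.monotone (Fin.zero_le t), hd.monotone (Fin.le_last t)⟩
  have hsp : ∀ k ∈ sideList c x (d 0) (d 8), LadderIndex c a b k ∧ k < K := fun k hk =>
    let h := mem_sideList.1 hk; hidx k h.1 h.2.1 h.2.2
  have hadj : ∀ i ∈ sideList c x (d 0) (d 8), ∀ j ∈ sideList c x (d 0) (d 8), i < j →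
      (G.Adj (w i) (w j) ↔ ∀ k ∈ sideList c x (d 0) (d 8), ¬ (i < k ∧ k < j)) := by
    intro i hi j hj hij
    have hi' := mem_sideList.1 hi
    have hj' := mem_sideList.1 hj
    rw [h.path i j (hsp i hi).1 (hsp j hj).1 (hi'.1.trans hj'.1.symm) hij]
    constructor
    · rintro ⟨-, hp⟩ k hk ⟨h4, h5⟩
      exact hp k h4 h5 ((mem_sideList.1 hk).1.trans hi'.1.symm)
    · refine fun hp => ⟨hij, fun k h4 h5 hck => hp k ?_ ⟨h4, h5⟩⟩
      exact mem_sideList.2 ⟨hck.trans hi'.1, by omega, by omega⟩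
  obtain ⟨u, v, P, h1, h2, h3⟩ := exists_induced_walk
    (List.ne_nil_of_mem (hdm 0)) (sideList_sorted x (d 0) (d 8))
    (fun i hi j hj => h.inj i j (hsp i hi).2 (hsp j hj).2) hadj
  refine ⟨u, v, P, h1, h2, h3, ?_⟩
  rw [h1, show (List.ofFn fun t => w (d t)) = (List.ofFn d).map w from List.map_ofFn .. |>.symm]
  exact (ofFn_sublist (sideList_sorted x _ _) hd hdm).map w

/-- The sides are the two colour classes. Only the four corners can have neighbours outside the
ladder, by the field `nbr`; the treewidth bound is inherited from `G[Y]`. -/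
theorem IsLadder.removes [Finite V] {Y : Set V} (hY : TreewidthAtMost (G.induce Y) 2)
    (h : IsLadder G K w c a b) (hw : ∀ k < K, w k ∈ Y) : LadderRemoves G s(w (a 4), w (b 4)) := by
  obtain ⟨u, v, P, hP, hPp, hPi, hPs⟩ := h.exists_side true a h.mono_a h.color_a
    fun k h1 h2 h3 => ⟨Or.inl ⟨h1, h2, h3⟩, h3.trans_lt (h.lt_a 8)⟩
  obtain ⟨u', v', Q, hQ, hQp, hQi, hQs⟩ := h.exists_side false b h.mono_b h.color_b
    fun k h1 h2 h3 => ⟨Or.inr ⟨h1, h2, h3⟩, h3.trans_lt (h.lt_b 8)⟩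
  have hidx : ∀ k, LadderIndex c a b k → k < K := by
    rintro k (⟨-, -, h3⟩ | ⟨-, -, h3⟩)
    · exact h3.trans_lt (h.lt_a 8)
    · exact h3.trans_lt (h.lt_b 8)
  have hmem : ∀ x, (x ∈ P.support ∨ x ∈ Q.support) ↔ ∃ k, LadderIndex c a b k ∧ x = w k := by
    intro x
    rw [hP, hQ, List.mem_map, List.mem_map]
    constructor
    · rintro (⟨k, hk, rfl⟩ | ⟨k, hk, rfl⟩)
      · exact ⟨k, Or.inl (mem_sideList.1 hk), rfl⟩
      · exact ⟨k, Or.inr (mem_sideList.1 hk), rfl⟩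
    · rintro ⟨k, hk | hk, rfl⟩
      · exact Or.inl ⟨k, mem_sideList.2 hk, rfl⟩
      · exact Or.inr ⟨k, mem_sideList.2 hk, rfl⟩
  refine ⟨u, v, u', v', P, Q, fun t => w (a t), fun t => w (b t), hPp, hPi, hQp, hQi, ?_, hPs, hQs,
    h.rung, ?_, ?_, rfl⟩
  · intro x hx hx'
    rw [hP, List.mem_map] at hx
    rw [hQ, List.mem_map] at hx'
    obtain ⟨i, hi, rfl⟩ := hx
    obtain ⟨j, hj, hij⟩ := hx'
    rw [mem_sideList] at hi hj
    obtain rfl := h.inj i j (hidx i (Or.inl hi)) (hidx j (Or.inr hj)) hij.symm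
    exact absurd (hi.1.symm.trans hj.1) (by simp)
  · refine hY.induce_mono ?_
    rintro x hx
    obtain ⟨k, hk, rfl⟩ := (hmem x).1 hx
    exact hw k (hidx k hk)
  · rintro x ⟨hx, y, hy, hyx⟩
    obtain ⟨k, hk, rfl⟩ := (hmem x).1 (not_not.1 hx)
    by_contra hcon
    simp only [Set.mem_insert_iff, Set.mem_singleton_iff, not_or] at hcon
    refine hy ((hmem y).2 (h.nbr k hk ?_ ?_ ?_ ?_ y hyx.symm))
    · rintro rfl; exact hcon.1 rfl
    · rintro rfl; exact hcon.2.1 rfl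
    · rintro rfl; exact hcon.2.2.1 rfl
    · rintro rfl; exact hcon.2.2.2 rfl

end Soundness

/-! ### First-order definability of fans and ladders -/

section Definability

/-- A property of a graph with a vertex set and a valuation that is expressed by a formula. -/
def Definable (Φ : ∀ n : ℕ, SimpleGraph (Fin n) → Finset (Fin n) → (ℕ → Fin n) → Prop) : Prop :=
  ∃ φ : Form, ∀ n G B ρ, φ.Realize (n := n) G B ρ ↔ Φ n G B ρ

namespace Definable

variable {Φ Ψ : ∀ n : ℕ, SimpleGraph (Fin n) → Finset (Fin n) → (ℕ → Fin n) → Prop}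

theorem congr (h : Definable Φ) (e : ∀ n G B ρ, Φ n G B ρ ↔ Ψ n G B ρ) : Definable Ψ :=
  h.imp fun _ hφ n G B ρ => (hφ n G B ρ).trans (e n G B ρ)

theorem adj (i j : ℕ) : Definable fun _ G _ ρ => G.Adj (ρ i) (ρ j) := ⟨.adj i j, fun _ _ _ _ => Iff.rfl⟩

theorem eq (i j : ℕ) : Definable fun _ _ _ ρ => ρ i = ρ j := ⟨.eq i j, fun _ _ _ _ => Iff.rfl⟩

theorem mem (i : ℕ) : Definable fun _ _ B ρ => ρ i ∈ B := ⟨.mem i, fun _ _ _ _ => Iff.rfl⟩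

theorem not (h : Definable Φ) : Definable fun n G B ρ => ¬ Φ n G B ρ := by
  obtain ⟨φ, hφ⟩ := h
  exact ⟨.not φ, fun n G B ρ => not_congr (hφ n G B ρ)⟩

theorem or (h : Definable Φ) (h' : Definable Ψ) : Definable fun n G B ρ => Φ n G B ρ ∨ Ψ n G B ρ := by
  obtain ⟨φ, hφ⟩ := h
  obtain ⟨ψ, hψ⟩ := h'
  exact ⟨.or φ ψ, fun n G B ρ => or_congr (hφ n G B ρ) (hψ n G B ρ)⟩

theorem and (h : Definable Φ) (h' : Definable Ψ) : Definable fun n G B ρ => Φ n G B ρ ∧ Ψ n G B ρ :=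
  (h.not.or h'.not).not.congr fun _ _ _ _ => by tauto

theorem imp (h : Definable Φ) (h' : Definable Ψ) : Definable fun n G B ρ => Φ n G B ρ → Ψ n G B ρ :=
  (h.not.or h').congr fun _ _ _ _ => by tauto

theorem iff (h : Definable Φ) (h' : Definable Ψ) : Definable fun n G B ρ => (Φ n G B ρ ↔ Ψ n G B ρ) :=
  ((h.imp h').and (h'.imp h)).congr fun _ _ _ _ => iff_def.symm

theorem const (p : Prop) : Definable fun _ _ _ _ => p := by
  by_cases hp : p
  · exact (eq 0 0).congr fun _ _ _ _ => by simp [hp]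
  · exact (eq 0 0).not.congr fun _ _ _ _ => by simp [hp]

theorem exists_finite {ι : Type*} [Finite ι]
    {Φ : ι → ∀ n : ℕ, SimpleGraph (Fin n) → Finset (Fin n) → (ℕ → Fin n) → Prop}
    (h : ∀ i, Definable (Φ i)) : Definable fun n G B ρ => ∃ i, Φ i n G B ρ := by
  classical
  have := Fintype.ofFinite ι
  suffices ∀ s : Finset ι, Definable fun n G B ρ => ∃ i ∈ s, Φ i n G B ρ from
    (this Finset.univ).congr fun _ _ _ _ => by simp
  intro s
  induction s using Finset.induction_on with
  | empty => exact (const False).congr fun _ _ _ _ => by simp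
  | insert i s _ ih => exact ((h i).or ih).congr fun _ _ _ _ => by simp

theorem forall_finite {ι : Type*} [Finite ι]
    {Φ : ι → ∀ n : ℕ, SimpleGraph (Fin n) → Finset (Fin n) → (ℕ → Fin n) → Prop}
    (h : ∀ i, Definable (Φ i)) : Definable fun n G B ρ => ∀ i, Φ i n G B ρ :=
  (exists_finite fun i => (h i).not).not.congr fun _ _ _ _ => by simp

theorem ex (i : ℕ) (h : Definable Φ) :
    Definable fun n G B ρ => ∃ x, Φ n G B (Function.update ρ i x) := by
  obtain ⟨φ, hφ⟩ := h
  exact ⟨.ex i φ, fun n G B ρ => exists_congr fun x => hφ n G B _⟩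

theorem all (i : ℕ) (h : Definable Φ) :
    Definable fun n G B ρ => ∀ x, Φ n G B (Function.update ρ i x) :=
  (h.not.ex i).not.congr fun _ _ _ _ => by simp

theorem ex_range (a k : ℕ) (h : Definable Φ) :
    Definable fun n G B ρ => ∃ ρ', (∀ i, ¬ (a ≤ i ∧ i < a + k) → ρ' i = ρ i) ∧ Φ n G B ρ' := by
  induction k with
  | zero =>
    refine h.congr fun n G B ρ => ⟨fun h => ⟨ρ, fun _ _ => rfl, h⟩, ?_⟩
    rintro ⟨ρ', h1, h2⟩
    rwa [funext fun i => h1 i (by omega)] at h2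
  | succ k ih =>
    refine (ih.ex (a + k)).congr fun n G B ρ => ⟨?_, ?_⟩
    · rintro ⟨x, ρ', h1, h2⟩
      refine ⟨ρ', fun i hi => ?_, h2⟩
      rw [h1 i (by omega), Function.update_of_ne (by omega)]
    · rintro ⟨ρ', h1, h2⟩
      refine ⟨ρ' (a + k), ρ', fun i hi => ?_, h2⟩
      by_cases hik : i = a + k
      · subst hik; simp
      · rw [Function.update_of_ne hik, h1 i (by omega)]

end Definable

theorem IsLadder.congr {V : Type*} {G : SimpleGraph V} {K : ℕ} {w w' : ℕ → V} {c c' : ℕ → Bool}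
    {a b : Fin 9 → ℕ} (h : IsLadder G K w c a b) (hw : ∀ k < K, w k = w' k)
    (hc : ∀ k < K, c k = c' k) : IsLadder G K w' c' a b := by
  have h1 : ∀ k, LadderIndex c' a b k ↔ LadderIndex c a b k := by
    intro k
    by_cases hk : k < K
    · simp only [LadderIndex, hc k hk]
    · have := h.lt_a 8
      have := h.lt_b 8
      simp only [LadderIndex]
      exact ⟨by rintro (h | h) <;> omega, by rintro (h | h) <;> omega⟩
  have h2 : ∀ k, LadderIndex c a b k → k < K := by
    have := h.lt_a 8
    have := h.lt_b 8
    rintro k (h | h) <;> omega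
  have h3 : ∀ i j, j < K → (Prec c' i j ↔ Prec c i j) := by
    intro i j hj
    refine and_congr_right fun hij => forall_congr' fun k => forall_congr' fun _ =>
      forall_congr' fun hk => ?_
    rw [hc k (hk.trans hj), hc i (hij.trans hj)]
  refine ⟨h.mono_a, h.mono_b, fun t => ?_, fun t => ?_, h.lt_a, h.lt_b, ?_, ?_, fun t => ?_, ?_⟩
  · rw [← hc _ (h.lt_a t), h.color_a]
  · rw [← hc _ (h.lt_b t), h.color_b]
  · intro i j hi hj; rw [← hw i hi, ← hw j hj]; exact h.inj i j hi hj
  · intro i j hi hj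
    rw [h1] at hi hj
    rw [← hc i (h2 i hi), ← hc j (h2 j hj), ← hw i (h2 i hi), ← hw j (h2 j hj), h3 i j (h2 j hj)]
    exact h.path i j hi hj
  · rw [← hw _ (h.lt_a t), ← hw _ (h.lt_b t)]; exact h.rung t
  · intro k hk g1 g2 g3 g4 u hu
    rw [h1] at hk
    rw [← hw k (h2 k hk)] at hu
    obtain ⟨l, hl, rfl⟩ := h.nbr k hk g1 g2 g3 g4 u hu
    exact ⟨l, (h1 l).2 hl, hw l (h2 l hl)⟩

/-- All index quantifiers are bounded by `K` here, so they unfold into finite conjunctions and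
disjunctions; the one over `u` remains a quantifier over vertices. -/
theorem isLadder_iff {V : Type*} {G : SimpleGraph V} {K : ℕ} {w : ℕ → V} {c : ℕ → Bool}
    {a b : Fin 9 → ℕ} : IsLadder G K w c a b ↔
      (StrictMono a ∧ StrictMono b ∧ (∀ t, c (a t) = true) ∧ (∀ t, c (b t) = false) ∧
        (∀ t, a t < K) ∧ ∀ t, b t < K) ∧
      (∀ i j : Fin K, w i = w j → i = j) ∧
      (∀ i j : Fin K, (LadderIndex c a b i ∧ LadderIndex c a b j ∧ c i = c j ∧ i < j) →
        (G.Adj (w i) (w j) ↔ Prec c i j)) ∧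
      (∀ t, G.Adj (w (a t)) (w (b t))) ∧
      ∀ k : Fin K, (LadderIndex c a b k ∧ (k : ℕ) ≠ a 0 ∧ (k : ℕ) ≠ a 8 ∧ (k : ℕ) ≠ b 0 ∧
        (k : ℕ) ≠ b 8) → ∀ u, G.Adj (w k) u → ∃ l : Fin K, LadderIndex c a b l ∧ u = w l := by
  constructor
  · rintro ⟨h1, h2, h3, h4, h5, h6, h7, h8, h9, h10⟩
    refine ⟨⟨h1, h2, h3, h4, h5, h6⟩, fun i j h => Fin.ext (h7 i j i.2 j.2 h),
      fun i j h => h8 i j h.1 h.2.1 h.2.2.1 h.2.2.2, h9, fun k h u hu => ?_⟩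
    obtain ⟨l, hl, rfl⟩ := h10 k h.1 h.2.1 h.2.2.1 h.2.2.2.1 h.2.2.2.2 u hu
    have hlK : l < K := by
      have := h5 8
      have := h6 8
      rcases hl with h | h <;> omega
    exact ⟨⟨l, hlK⟩, hl, rfl⟩
  · rintro ⟨⟨h1, h2, h3, h4, h5, h6⟩, h7, h8, h9, h10⟩
    have hlt : ∀ l, LadderIndex c a b l → l < K := by
      intro l hl
      have := h5 8
      have := h6 8
      rcases hl with h | h <;> omega
    refine ⟨h1, h2, h3, h4, h5, h6, fun i j hi hj h => ?_, fun i j hi hj hc hij => ?_, h9,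
      fun k hk g1 g2 g3 g4 u hu => ?_⟩
    · simpa using h7 ⟨i, hi⟩ ⟨j, hj⟩ h
    · exact h8 ⟨i, hlt i hi⟩ ⟨j, hlt j hj⟩ ⟨hi, hj, hc, hij⟩
    · obtain ⟨l, hl, h⟩ := h10 ⟨k, hlt k hk⟩ ⟨hk, g1, g2, g3, g4⟩ u hu
      exact ⟨l, hl, h⟩

/-- The colouring and the rung indices are fixed parameters, so every condition on them is a
constant truth value. Variable `o + K`, just after the block of ladder vertices, is bound to the
neighbour `u`. -/
theorem definable_isLadder (K o : ℕ) (c : ℕ → Bool) (a b : Fin 9 → ℕ) :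
    Definable fun _ G _ ρ => IsLadder G K (fun k => ρ (o + k)) c a b := by
  refine Definable.congr ?_ fun n G B ρ => isLadder_iff.symm
  refine (Definable.const _).and (.and ?_ (.and ?_ (.and ?_ ?_)))
  · exact .forall_finite fun i => .forall_finite fun j => (Definable.eq _ _).imp (.const _)
  · exact .forall_finite fun i => .forall_finite fun j =>
      (Definable.const _).imp ((Definable.adj _ _).iff (.const _))
  · exact .forall_finite fun t => .adj _ _
  · refine .forall_finite fun k => (Definable.const _).imp ?_
    have h : Definable fun _ G _ ρ => G.Adj (ρ (o + k)) (ρ (o + K)) →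
        ∃ l : Fin K, LadderIndex c a b l ∧ ρ (o + K) = ρ (o + l) :=
      (Definable.adj _ _).imp (.exists_finite fun l => (Definable.const _).and (.eq _ _))
    refine (h.all (o + K)).congr fun n G B ρ => ?_
    have e : ∀ (x : Fin n) (l : Fin K), Function.update ρ (o + K) x (o + l) = ρ (o + l) :=
      fun x l => Function.update_of_ne (by have := l.2; omega) _ _
    simp only [e, Function.update_self]

theorem isFan_iff {V : Type*} {G : SimpleGraph V} {x v₁ v₂ v₃ v₄ : V} :
    IsFan G x v₁ v₂ v₃ v₄ ↔ G.Adj x v₁ ∧ G.Adj x v₄ ∧ (∀ u, G.Adj v₂ u ↔ u = x ∨ u = v₁ ∨ u = v₃) ∧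
      (∀ u, G.Adj v₃ u ↔ u = x ∨ u = v₂ ∨ u = v₄) ∧ v₁ ≠ v₃ ∧ v₁ ≠ v₄ ∧ v₂ ≠ v₄ :=
  ⟨fun ⟨h1, h2, h3, h4, h5, h6, h7⟩ => ⟨h1, h2, h3, h4, h5, h6, h7⟩,
    fun ⟨h1, h2, h3, h4, h5, h6, h7⟩ => ⟨h1, h2, h3, h4, h5, h6, h7⟩⟩

theorem definable_isFan : Definable fun _ G _ ρ => IsFan G (ρ 1) (ρ 2) (ρ 0) (ρ 3) (ρ 4) := by
  refine Definable.congr ?_ fun n G B ρ => isFan_iff.symm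
  refine (Definable.adj _ _).and (.and (.adj _ _) (.and ?_ (.and ?_ (.and (Definable.eq _ _).not
    (.and (Definable.eq _ _).not (Definable.eq _ _).not)))))
  · have h : Definable fun _ G _ ρ => G.Adj (ρ 0) (ρ 5) ↔ ρ 5 = ρ 1 ∨ ρ 5 = ρ 2 ∨ ρ 5 = ρ 3 :=
      (Definable.adj _ _).iff ((Definable.eq _ _).or ((Definable.eq _ _).or (.eq _ _)))
    refine (h.all 5).congr fun n G B ρ => ?_
    simp
  · have h : Definable fun _ G _ ρ => G.Adj (ρ 3) (ρ 5) ↔ ρ 5 = ρ 1 ∨ ρ 5 = ρ 0 ∨ ρ 5 = ρ 4 :=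
      (Definable.adj _ _).iff ((Definable.eq _ _).or ((Definable.eq _ _).or (.eq _ _)))
    refine (h.all 5).congr fun n G B ρ => ?_
    simp

/-- The valuation describes a fan or a ladder in `B`, and the variables `0` and `1` form the edge to
be removed. -/
def IsCertificate (n : ℕ) (G : SimpleGraph (Fin n)) (B : Finset (Fin n)) (ρ : ℕ → Fin n) : Prop :=
  (IsFan G (ρ 1) (ρ 2) (ρ 0) (ρ 3) (ρ 4) ∧ ∀ i : Fin 5, ρ i ∈ B) ∨
  ∃ (c : Fin 200 → Bool) (a b : Fin 9 → Fin 200),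
    IsLadder G 200 (fun k => ρ (2 + k)) (fun k => if h : k < 200 then c ⟨k, h⟩ else false)
      (fun t => a t) (fun t => b t) ∧ (∀ k : Fin 200, ρ (2 + k) ∈ B) ∧
      ρ 0 = ρ (2 + a 4) ∧ ρ 1 = ρ (2 + b 4)

theorem definable_isCertificate : Definable IsCertificate := by
  refine Definable.or (definable_isFan.and (.forall_finite fun i => .mem _)) ?_
  refine .exists_finite fun c => .exists_finite fun a => .exists_finite fun b => ?_
  exact (definable_isLadder 200 2 _ _ _).and ((Definable.forall_finite fun k => .mem _).and
    ((Definable.eq _ _).and (.eq _ _)))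

theorem IsCertificate.congr {n : ℕ} {G : SimpleGraph (Fin n)} {B : Finset (Fin n)}
    {ρ ρ' : ℕ → Fin n} (h : IsCertificate n G B ρ) (e : ∀ i < 202, ρ i = ρ' i) :
    IsCertificate n G B ρ' := by
  rcases h with ⟨h1, h2⟩ | ⟨c, a, b, h1, h2, h3, h4⟩
  · refine Or.inl ⟨?_, fun i => ?_⟩
    · rwa [← e 0 (by omega), ← e 1 (by omega), ← e 2 (by omega), ← e 3 (by omega), ← e 4 (by omega)]
    · rw [← e i (by omega)]; exact h2 i
  · refine Or.inr ⟨c, a, b, h1.congr (fun k hk => e _ (by omega)) (fun _ _ => rfl), fun k => ?_, ?_, ?_⟩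
    · rw [← e _ (by omega)]; exact h2 k
    · rw [← e 0 (by omega), ← e _ (by omega)]; exact h3
    · rw [← e 1 (by omega), ← e _ (by omega)]; exact h4

end Definability

/-! ### Existence and soundness of certificates -/

section Certificates

/-- Vertices off the boundary of `B` have the same neighbours in `G` as in `G[B]`, and the fan
restricts the neighbourhoods of its inner vertices only. -/
theorem IsFan.of_induce {V : Type*} {G : SimpleGraph V} {B : Set V} {x v₁ v₂ v₃ v₄ : B}
    (h : IsFan (G.induce B) x v₁ v₂ v₃ v₄) (h₂ : ∀ u, G.Adj v₂ u → u ∈ B)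
    (h₃ : ∀ u, G.Adj v₃ u → u ∈ B) : IsFan G (x : V) v₁ v₂ v₃ v₄ := by
  have aux : ∀ v a b c : B, (∀ u, G.Adj v u → u ∈ B) →
      (∀ u, (G.induce B).Adj v u ↔ u = a ∨ u = b ∨ u = c) →
      ∀ u, G.Adj v u ↔ u = a ∨ u = b ∨ u = c := by
    intro v a b c hv hadj u
    constructor
    · intro hu
      have := (hadj ⟨u, hv u hu⟩).1 hu
      simpa [Subtype.ext_iff] using this
    · intro hu
      have huB : u ∈ B := by rcases hu with rfl | rfl | rfl <;> exact Subtype.prop _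
      exact (hadj ⟨u, huB⟩).2 (by simpa [Subtype.ext_iff] using hu)
  exact ⟨h.adj₁, h.adj₄, aux _ _ _ _ h₂ h.nbr₂, aux _ _ _ _ h₃ h.nbr₃,
    fun e => h.ne₁₃ (Subtype.ext e), fun e => h.ne₁₄ (Subtype.ext e), fun e => h.ne₂₄ (Subtype.ext e)⟩

theorem IsLadder.of_induce {V : Type*} {G : SimpleGraph V} {B : Set V} {K : ℕ} {w : ℕ → B}
    {c : ℕ → Bool} {a b : Fin 9 → ℕ} (h : IsLadder (G.induce B) K w c a b)
    (hB : ∀ k < K, ∀ u, G.Adj (w k) u → u ∈ B) : IsLadder G K (fun k => (w k : V)) c a b := by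
  have hlt : ∀ k, LadderIndex c a b k → k < K := by
    have := h.lt_a 8
    have := h.lt_b 8
    rintro k (h | h) <;> omega
  refine ⟨h.mono_a, h.mono_b, h.color_a, h.color_b, h.lt_a, h.lt_b,
    fun i j hi hj e => h.inj i j hi hj (Subtype.ext e), h.path, h.rung, ?_⟩
  intro k hk g1 g2 g3 g4 u hu
  obtain ⟨l, hl, e⟩ := h.nbr k hk g1 g2 g3 g4 ⟨u, hB k (hlt k hk) u hu⟩ hu
  exact ⟨l, hl, congrArg Subtype.val e⟩

theorem exists_isCertificate {n : ℕ} {G : SimpleGraph (Fin n)} {X B : Finset (Fin n)}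
    (hC : ¬ ContractComponentApplicable G) (hX : IsTidyModulator G (X : Set (Fin n)))
    (hd : Disjoint B X) (hB : IsBiconnected (G.induce (B : Set (Fin n))))
    (hcard : 1988 * X.card + 2 ≤ B.card) : ∃ ρ, IsCertificate n G B ρ := by
  classical
  have hd' : Disjoint (B : Set (Fin n)) (X : Set (Fin n)) := Finset.disjoint_coe.2 hd
  set H := G.induce (B : Set (Fin n)) with hH
  obtain ⟨d, hdB⟩ : B.Nonempty := Finset.card_pos.1 (by omega)
  have htw : TreewidthAtMost H 2 := hX.1.induce_mono fun v hv hvX => Set.disjoint_left.1 hd' hv hvX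
  obtain ⟨E, -⟩ := exists_elimination htw ⟨d, hdB⟩
  have hcut := hB.noCutVertex
  let M : Finset (B : Set (Fin n)) := Finset.univ.filter fun w => (w : Fin n) ∈ boundary G B
  have hin : ∀ w ∉ M, ∀ u, G.Adj (w : Fin n) u → u ∈ (B : Set (Fin n)) := by
    intro w hw u hu
    by_contra huB
    exact hw (Finset.mem_filter.2 ⟨Finset.mem_univ _, not_not.2 w.2, u, huB, hu.symm⟩)
  have hMcard : M.card ≤ 2 * X.card := by
    refine le_trans ?_ (ncard_boundary_le hX hC hd' hB)
    rw [← Finset.card_map (Function.Embedding.subtype _), ← Set.ncard_coe_finset]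
    refine Set.ncard_le_ncard ?_ (Set.toFinite _)
    intro v hv
    simp only [Finset.coe_map, Set.mem_image, Finset.mem_coe] at hv
    obtain ⟨w, hw, rfl⟩ := hv
    exact (Finset.mem_filter.1 hw).2
  have hM : ∀ v ∉ M, 2 < (H.neighborSet v).ncard := by
    intro v hv
    have h1 := two_lt_ncard_neighborSet hC (v : Fin n)
    have h2 : G.neighborSet v ⊆ Subtype.val '' H.neighborSet v :=
      fun u hu => ⟨⟨u, hin v hv u hu⟩, hu, rfl⟩
    exact h1.trans_le ((Set.ncard_le_ncard h2 (Set.toFinite _)).trans (Set.ncard_image_le (Set.toFinite _)))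
  have hWcard : Fintype.card (B : Set (Fin n)) = B.card := by simp
  -- A strip of length 200 needs a chain of 202 vertices. As `|M| ≤ 2|X|`, more than `2 * 2 * 202 *
  -- |X| = 808 * |X|` vertices suffice, and the hypothesis on `B` gives that many.
  obtain ⟨w₀, hw₀⟩ := E.exists_chain M hM 202 (by rw [hWcard]; omega)
  obtain ⟨z, hz⟩ := exists_isStrip hcut M hM 200 E w₀ hw₀
  by_cases hfan : ∃ x i, i + 4 ≤ 200 ∧ IsFan H x (w₀ (i + 1)) (w₀ (i + 1 + 1)) (w₀ (i + 2 + 1)) (w₀ (i + 3 + 1))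
  · obtain ⟨x, i, hi, hf⟩ := hfan
    have hf' := hf.of_induce (hin _ (hw₀ (i + 1 + 1) (by omega)).1) (hin _ (hw₀ (i + 2 + 1) (by omega)).1)
    refine ⟨fun k => if k = 0 then w₀ (i + 1 + 1) else if k = 1 then x else if k = 2 then w₀ (i + 1)
      else if k = 3 then w₀ (i + 2 + 1) else w₀ (i + 3 + 1), Or.inl ⟨by simpa using hf', fun k => ?_⟩⟩
    beta_reduce
    split_ifs <;> exact Subtype.prop _
  · obtain ⟨c, hc⟩ := hz.exists_coloring (by omega) hfan
    obtain ⟨a, b, hab⟩ := hc.exists_isLadder le_rfl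
    have hab' := hab.of_induce fun k hk => hin _ (hw₀ (k + 1) (by omega)).1
    refine ⟨fun k => if k = 0 then w₀ (a 4 + 1) else if k = 1 then w₀ (b 4 + 1) else w₀ (k - 2 + 1),
      Or.inr ⟨fun k => c k, fun t => ⟨a t, hab.lt_a t⟩, fun t => ⟨b t, hab.lt_b t⟩, ?_, ?_, ?_, ?_⟩⟩
    · refine hab'.congr (fun k hk => ?_) fun k hk => ?_
      · beta_reduce
        rw [if_neg (by omega), if_neg (by omega), Nat.add_sub_cancel_left]
      · rw [dif_pos hk]
    · intro k
      beta_reduce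
      rw [if_neg (by omega), if_neg (by omega)]
      exact Subtype.prop _
    · beta_reduce
      rw [if_pos rfl, if_neg (by omega), if_neg (by omega), Nat.add_sub_cancel_left]
    · beta_reduce
      rw [if_neg one_ne_zero, if_pos rfl, if_neg (by omega), if_neg (by omega), Nat.add_sub_cancel_left]

theorem IsCertificate.sound {n : ℕ} {G : SimpleGraph (Fin n)} {X B : Finset (Fin n)}
    (hX : IsTidyModulator G (X : Set (Fin n))) (hd : Disjoint B X) {ρ : ℕ → Fin n}
    (h : IsCertificate n G B ρ) (t : ℕ) :
    G.Adj (ρ 0) (ρ 1) ∧ ρ 0 ∈ B ∧ ρ 1 ∈ B ∧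
      (FrequentPathNeighbourRemoves G t s(ρ 0, ρ 1) ∨ LadderRemoves G s(ρ 0, ρ 1)) := by
  have hBX : ∀ v ∈ B, v ∉ (X : Set (Fin n)) := fun v hv h => Finset.disjoint_left.1 hd hv h
  rcases h with ⟨h, hB⟩ | ⟨c, a, b, h, hB, h0, h1⟩
  · refine ⟨(h.nbr₂ _).2 (Or.inl rfl), hB 0, hB 1, Or.inl ?_⟩
    exact h.removes hX (hBX _ (hB 1)) (hBX _ (hB 2)) (hBX _ (hB 0)) (hBX _ (hB 3)) (hBX _ (hB 4)) t
  · rw [h0, h1]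
    exact ⟨h.rung 4, hB _, hB _, Or.inr (h.removes hX.1 fun k hk => hBX _ (hB ⟨k, hk⟩))⟩

end Certificates
end TidyReduction

open TidyReduction
theorem mainTheorem6 :
    ∃ (prog : RamProg) (bound : Polynomial ℕ),
      ∀ (n : ℕ) (G : SimpleGraph (Fin n)) (t : ℕ) (X B : Finset (Fin n)),
        ¬ IsTrivialInstance G t →
        IsTidyModulator G (X : Set (Fin n)) →
        Disjoint B X →
        IsBiconnected (G.induce (B : Set (Fin n))) →
        1988 * X.card + 2 ≤ B.card →
        ∃ (k : ℕ) (s : RamState) (e : Sym2 (Fin n)),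
          k ≤ bound.eval n ∧
          Exec prog (inputState G t X B) k s ∧
          e ∈ G.edgeSet ∧ (∀ v ∈ e, v ∈ B) ∧
          (FrequentPathNeighbourRemoves G t e ∨ LadderRemoves G e) ∧
          HoldsInstance s (G.deleteEdges {e}) t := by
  -- Quantifying over the 200 vertices of the configuration, in variables 2 to 201, leaves a formula
  -- about the two ends of the edge to be removed.
  obtain ⟨φ, hφ⟩ := definable_isCertificate.ex_range 2 200
  obtain ⟨prog, bound, hprog⟩ := exists_prog_deleteEdge φ
  refine ⟨prog, bound, fun n G t X B htriv hX hd hB hcard => ?_⟩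
  have hC : ¬ ContractComponentApplicable G := fun h => htriv (Or.inr (Or.inr (Or.inr h)))
  obtain ⟨ρ₁, hρ₁⟩ := exists_isCertificate hC hX hd hB hcard
  obtain ⟨k, s, ρ, hk, hexec, hρ, hs⟩ := hprog n G t X B
    ⟨ρ₁, (hφ n G B ρ₁).2 ⟨ρ₁, fun _ _ => rfl, hρ₁⟩⟩ fun ρ ρ' h0 h1 h => by
      obtain ⟨ρ'', h2, h3⟩ := (hφ n G B ρ).1 h
      refine (hφ n G B ρ').2 ⟨fun i => if 2 ≤ i ∧ i < 2 + 200 then ρ'' i else ρ' i,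
        fun i hi => if_neg hi, h3.congr fun i hi => ?_⟩
      by_cases hi' : 2 ≤ i ∧ i < 2 + 200
      · rw [if_pos hi']
      · rw [if_neg hi', h2 i hi']
        obtain rfl | rfl : i = 0 ∨ i = 1 := by omega
        exacts [h0, h1]
  obtain ⟨ρ', h1, h2⟩ := (hφ n G B ρ).1 hρ
  obtain ⟨hadj, hB0, hB1, hrem⟩ := h2.sound hX hd t
  rw [h1 0 (by omega), h1 1 (by omega)] at hadj hrem
  rw [h1 0 (by omega)] at hB0
  rw [h1 1 (by omega)] at hB1
  refine ⟨k, s, s(ρ 0, ρ 1), hk, hexec, hadj, ?_, hrem, hs⟩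
  intro v hv
  rcases Sym2.mem_iff.1 hv with rfl | rfl
  exacts [hB0, hB1]
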